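/- Conventions. A marked rational plane tropical curve $C=(\Gamma,x_1,\dots,x_n,h)$ is a metric tree $\Gamma$ with vertices of valence $\ge 3$, with unbounded ends, $n$ of which are the markings $x_i$, and a map $h:\Gamma\to\mathbb{R}^2$ that is affine with integral direction vector on every edge, balanced at every vertex, and contracts the markings. It has degree $d$ if the directions of its non-marked ends are $(-1,0),(0,-1),(1,1)$, each $d$ times. Let $\mathcal{M}_{d,n}$ be the space of these curves, $ev_i(C)=h(x_i)$, and let $\delta$ be the forgetful map to the space $\mathcal{M}_4$ of $4$-marked abstract tropical curves given by $x_1,\dots,x_4$. An element of $\mathcal{M}_4$ is of type (A), (B), (C) if it has one bounded edge (of some length $>0$) separating the markings as $12|34$, $13|24$, $14|23$ respectively, and of type (D) if it has no bounded edge. Let $d\ge 2$, $n=3d$, and let $\mathcal{L}^l$ be a plane tropical curve of degree $l$. Let $$\tilde\pi=ev_3\times\cdots\times ev_n\times\delta:\ \{C\in\mathcal{M}_{d,n}:\ h(x_1),h(x_2)\in\mathcal{L}^l,\ h(x_1)\ne h(x_2)\}\longrightarrow \mathbb{R}^{2n-4}\times\mathcal{M}_4 .$$ A point $\mathcal{Q}$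 of the target is in $\tilde\pi$-general position if its $\mathcal{M}_4$-coordinate is not of type (D) and every $C\in\tilde\pi^{-1}(\mathcal{Q})$ is generic, i.e. $3$-valent with $h(x_1),h(x_2)$ in relative interiors of edges of $\mathcal{L}^l$. Multiplicities are absolute values of determinants of the linear maps in the coordinates given by the image of a root vertex and the lengths of the bounded edges; for $mult_C(\tilde\pi)$, the two conditions $h(x_i)\in\mathcal{L}^l$ ($i=1,2$) enter as two rows $\det(u_i,h(x_i))$, where $u_i$ is the direction vector, weight included, of the edge of $\mathcal{L}^l$ through $h(x_i)$, and the $\mathcal{M}_4$-row is the length coordinate. **Proposition.** Let $\mathcal{Q}=(q_3,\dots,q_n,z)$ be in $\tilde\pi$-general position with $z$ of type (B) and of any length (in particular, of large length). Let $C\in\tilde\pi^{-1}(\mathcal{Q})$ have a contracted bounded edge $E$ such that cutting $C$ at $E$ (which becomes an additional marking $P$ on one part and $Q$ on the other) gives curves $C_1,C_2$ of degrees $d_1,d_2>0$ with $d_1+d_2=d$, with $x_1,x_3$ on $C_1$, with $x_2,x_4$ on $C_2$, and with exactly $3d_1-2$ of $x_5,\dots,x_n$ on $C_1$. Then $$mult_C(\tilde\pi)=mult_{C_1}(ev)\cdot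 mult_{C_2}(ev)\cdot (C_1\cdot C_2)_{P=Q}\cdot (C_1\cdot\mathcal{L}^l)_{x_1}\cdot (C_2\cdot\mathcal{L}^l)_{x_2}.$$ Here $mult_{C_i}(ev)$ is the multiplicity of the product of the evaluations at the $3d_i-1$ markings among $x_3,\dots,x_n$ that lie on $C_i$, taken at the curve obtained from $C_i$ by forgetting its other two markings ($x_i$, and $P$ or $Q$). The intersection multiplicities $(C_1\cdot C_2)_{P=Q}$ and $(C_i\cdot\mathcal{L}^l)_{x_i}$ are the absolute values of the determinants of the direction vectors, weights included, of the two edges meeting there. -/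

import Mathlib

namespace TropicalTangency

noncomputable section

open scoped Classical

/-! ### Plane vectors and determinants -/

/-- The determinant of two plane vectors. -/
def cross {R : Type} [CommRing R] (u v : Fin 2 → R) : R := u 0 * v 1 - u 1 * v 0

/-- The absolute value of the determinant of an integer matrix whose rows and columns are indexed
by two (possibly different) finite sets of the same size. Up to sign the determinant does not depend
on the bijection used to identify the two index sets. (It is `0` if the matrix is not square.) -/
def absDet {m n : Type} [Fintype m] [Fintype n] (M : Matrix m n ℤ) : ℕ :=
  if h : Nonempty (m ≃ n) then (M.submatrix id h.some).det.natAbs else 0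

/-! ### Graphs with unbounded ends, markings and a map to the plane -/

/-- The combinatorial data of a marked graph mapped to the plane.
`V` is the set of vertices, `graph` records the bounded edges, `len a b` is the length of the bounded
edge `ab`, `dir a b` the direction vector of the flag `(a, ab)` (pointing from `a` to `b`) and `pos`
the images of the vertices. `ends` is the set of non-marked unbounded edges, attached at
`endAt` and with direction `endDir`. The marked unbounded edges are indexed by `ι`; they are attached
at the vertices `mark i` and contracted by the map to the plane, so their direction is `0`. -/
structure MarkedGraph (ι : Type) where
  V : Type
  [fintypeV : Fintype V]
  graph : SimpleGraph V
  len : V → V → ℝ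
  dir : V → V → Fin 2 → ℤ
  pos : V → Fin 2 → ℝ
  ends : Type
  [fintypeEnds : Fintype ends]
  endAt : ends → V
  endDir : ends → Fin 2 → ℤ
  mark : ι → V

attribute [instance] MarkedGraph.fintypeV MarkedGraph.fintypeEnds

namespace MarkedGraph

variable {ι : Type}

/-- The valence of a vertex: the number of its flags (bounded edges, unbounded edges, markings). -/
def valence (C : MarkedGraph ι) (v : C.V) : ℕ :=
  Nat.card {w : C.V // C.graph.Adj v w} + Nat.card {e : C.ends // C.endAt e = v}
    + Nat.card {i : ι // C.mark i = v}

/-- `C` is a (rational) marked plane tropical curve: the graph is a tree all of whose vertices have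
valence at least `3`, bounded edges have positive lengths, the map to the plane is affine
on each edge with integral direction vector, and every vertex is balanced. -/
structure IsPlaneTropicalCurve (C : MarkedGraph ι) : Prop where
  isTree : C.graph.IsTree
  three_le_valence : ∀ v, 3 ≤ C.valence v
  len_pos : ∀ a b, C.graph.Adj a b → 0 < C.len a b
  len_symm : ∀ a b, C.graph.Adj a b → C.len b a = C.len a b
  dir_symm : ∀ a b, C.graph.Adj a b → C.dir b a = - C.dir a b
  pos_eq : ∀ a b, C.graph.Adj a b → ∀ k, C.pos b k = C.pos a k + C.len a b * (C.dir a b k : ℝ)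
  balanced : ∀ v, (∑ w with C.graph.Adj v w, C.dir v w) + (∑ e with C.endAt e = v, C.endDir e) = 0

/-- `C` has degree `d`: the multiset of directions of its non-marked unbounded edges consists
of `(-1,0)`, `(0,-1)` and `(1,1)`, each of them `d` times. -/
def HasDegree (C : MarkedGraph ι) (d : ℕ) : Prop :=
  (Finset.univ : Finset C.ends).val.map C.endDir
    = d • ({![-1, 0], ![0, -1], ![1, 1]} : Multiset (Fin 2 → ℤ))

/-- The image point `h(x_i)` of the marking `i`. -/
def ev (C : MarkedGraph ι) (i : ι) : Fin 2 → ℝ := C.pos (C.mark i)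

/-- `v` lies on the side of `a` when the edge `ab` is removed. -/
def OnSide (C : MarkedGraph ι) (a b v : C.V) : Prop :=
  (C.graph.deleteEdges {s(a, b)}).Reachable a v

/-! ### Forgetting a marking -/

/-- Remove the marking `x` (without straightening). -/
def drop (C : MarkedGraph ι) (x : ι) : MarkedGraph {i : ι // i ≠ x} where
  V := C.V
  graph := C.graph
  len := C.len
  dir := C.dir
  pos := C.pos
  ends := C.ends
  endAt := C.endAt
  endDir := C.endDir
  mark i := C.mark i

/-- Straighten a vertex `v` of valence `2` with a neighbour `w`: if both edges at `v` are bounded,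
they are merged to a single bounded edge; otherwise, `v` lies on the bounded edge `vw` and on an
unbounded edge, which are merged to an unbounded edge attached at `w`. -/
def straighten (C : MarkedGraph ι) (v w : C.V) (hvw : C.graph.Adj v w) : MarkedGraph ι where
  V := {u : C.V // u ≠ v}
  graph := SimpleGraph.fromRel fun s t : {u : C.V // u ≠ v} =>
    C.graph.Adj s t ∨ (C.graph.Adj s v ∧ C.graph.Adj v t)
  len s t := if C.graph.Adj s t then C.len s t else C.len s v + C.len v t
  dir s t := if C.graph.Adj s t then C.dir s t else C.dir s v
  pos s := C.pos s
  ends := C.ends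
  endAt e := if h : C.endAt e = v then ⟨w, hvw.ne'⟩ else ⟨C.endAt e, h⟩
  endDir := C.endDir
  mark i := if h : C.mark i = v then ⟨w, hvw.ne'⟩ else ⟨C.mark i, h⟩

/-- The forgetful map: remove the marking `x` and, if its vertex has become
`2`-valent, straighten that vertex. -/
def forget (C : MarkedGraph ι) (x : ι) : MarkedGraph {i : ι // i ≠ x} :=
  if h : (C.drop x).valence (C.mark x) = 2 ∧ ∃ w, (C.drop x).graph.Adj (C.mark x) w then
    (C.drop x).straighten (C.mark x) h.2.choose h.2.choose_spec
  else C.drop x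

/-! ### Splitting at a bounded edge -/

/-- The part of `C` on the side of `a` after cutting the bounded edge `ab`. The cut edge becomes
the additional marking `none`, attached at `a`. -/
def side (C : MarkedGraph ι) (a b : C.V) :
    MarkedGraph (Option {i : ι // C.OnSide a b (C.mark i)}) where
  V := {v : C.V // C.OnSide a b v}
  graph := C.graph.induce {v : C.V | C.OnSide a b v}
  len s t := C.len s t
  dir s t := C.dir s t
  pos s := C.pos s
  ends := {e : C.ends // C.OnSide a b (C.endAt e)}
  endAt e := ⟨C.endAt e, e.2⟩
  endDir e := C.endDir e
  mark
    | none => ⟨a, SimpleGraph.Reachable.refl a⟩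
    | some i => ⟨C.mark i, i.2⟩

/-! ### Coordinates on the cells of the moduli space and evaluation maps

On the cell of all curves of a given combinatorial type, coordinates are the image of a root vertex
`r` and the lengths of the bounded edges. In these coordinates the image of a vertex `t` is the sum of
`h(r)` and of `len e • dir e` over all bounded edges `e` on the path from `r` to `t`. -/

/-- The coefficient vector of the length of the bounded edge `e` in the image of the vertex `t`: the
direction vector of `e`, pointing from `r` to `t`, if `e` lies on the path from `r` to `t`, and `0`
otherwise. -/
def lengthCoeff (C : MarkedGraph ι) (r t : C.V) (e : C.graph.edgeSet) : Fin 2 → ℤ :=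
  ∑ p : C.V × C.V with s(p.1, p.2) = (e : Sym2 C.V) ∧ C.OnSide p.1 p.2 r ∧ C.OnSide p.2 p.1 t,
    C.dir p.1 p.2

/-- The image of the vertex `t` as a linear function of the coordinates of the cell. -/
def evCoeff (C : MarkedGraph ι) (r t : C.V) : Fin 2 ⊕ C.graph.edgeSet → Fin 2 → ℤ
  | .inl k => Pi.single k 1
  | .inr e => C.lengthCoeff r t e

/-- The matrix of the product of the evaluation maps at all markings, with respect to the root `r`. -/
def evMatrix (C : MarkedGraph ι) (r : C.V) : Matrix (ι × Fin 2) (Fin 2 ⊕ C.graph.edgeSet) ℤ :=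
  fun i c => C.evCoeff r (C.mark i.1) c i.2

/-- The multiplicity at `C` of the product `ev` of the evaluation maps at all markings of `C`. It does
not depend on the root vertex. -/
def evMult [Fintype ι] (C : MarkedGraph ι) : ℕ :=
  if h : Nonempty C.V then absDet (C.evMatrix h.some) else 0

/-! ### Directions and intersection multiplicities -/

/-- `u` is the direction vector of a non-marked flag at the vertex `v`. -/
def IsFlagDir (C : MarkedGraph ι) (v : C.V) (u : Fin 2 → ℤ) : Prop :=
  (∃ w, C.graph.Adj v w ∧ C.dir v w = u) ∨ ∃ e, C.endAt e = v ∧ C.endDir e = u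

/-- The direction vector (weight included, unique up to sign) of the edge on which the marking `x`
lies, if `x` is attached at a `3`-valent vertex: the other two flags at this vertex
have opposite directions. It is `0` if these flags are contracted. -/
def edgeDir (C : MarkedGraph ι) (x : ι) : Fin 2 → ℤ :=
  if h : ∃ u, u ≠ 0 ∧ C.IsFlagDir (C.mark x) u then h.choose else 0

/-- The intersection multiplicity at a common image point of a marking `P` on an edge of `C₁` and a
marking `Q` on an edge of `C₂`: the absolute value of the determinant of the two direction vectors. -/
def interMult {ι₁ ι₂ : Type} (C₁ : MarkedGraph ι₁) (P : ι₁) (C₂ : MarkedGraph ι₂) (Q : ι₂) : ℕ :=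
  (cross (C₁.edgeDir P) (C₂.edgeDir Q)).natAbs

end MarkedGraph

/-! ### Tropical plane curves of degree `l` -/

/-- A tropical plane curve of degree `l` (of any genus), given by a tropical polynomial
`max (coeff (i, j) + i x + j y)`, the maximum being over all `i, j ≥ 0` with `i + j ≤ l`. -/
structure TropicalCurve (l : ℕ) where
  coeff : {m : ℕ × ℕ // m.1 + m.2 ≤ l} → ℝ

namespace TropicalCurve

variable {l : ℕ}

/-- The value of the tropical monomial `m` at `p`. -/
def term (L : TropicalCurve l) (p : Fin 2 → ℝ) (m : {m : ℕ × ℕ // m.1 + m.2 ≤ l}) : ℝ :=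
  L.coeff m + m.1.1 * p 0 + m.1.2 * p 1

/-- `m` is a monomial at which the maximum is attained at `p`. -/
def IsMax (L : TropicalCurve l) (p : Fin 2 → ℝ) (m : {m : ℕ × ℕ // m.1 + m.2 ≤ l}) : Prop :=
  ∀ m', L.term p m' ≤ L.term p m

/-- The point `p` lies on the tropical curve: the maximum is attained at least twice. -/
def Contains (L : TropicalCurve l) (p : Fin 2 → ℝ) : Prop :=
  ∃ m m', m ≠ m' ∧ L.IsMax p m ∧ L.IsMax p m'

/-- `p` lies in the relative interior of an edge of the curve with weighted direction vector `u`
(weight times primitive direction): the monomials maximal at `p` lie on the segment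
between two of them, and `u` is the vector of this (dual) segment rotated by a right angle. -/
def IsEdgeVector (L : TropicalCurve l) (p : Fin 2 → ℝ) (u : Fin 2 → ℤ) : Prop :=
  ∃ m m', m ≠ m' ∧ L.IsMax p m ∧ L.IsMax p m' ∧
    (∀ k, L.IsMax p k → ∃ t : ℝ, 0 ≤ t ∧ t ≤ 1 ∧
      (k.1.1 : ℝ) = (1 - t) * m.1.1 + t * m'.1.1 ∧ (k.1.2 : ℝ) = (1 - t) * m.1.2 + t * m'.1.2) ∧
    u = ![-((m'.1.2 : ℤ) - m.1.2), (m'.1.1 : ℤ) - m.1.1]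

/-- The point `p` lies in the relative interior of an edge of the curve. -/
def OnEdge (L : TropicalCurve l) (p : Fin 2 → ℝ) : Prop := ∃ u, L.IsEdgeVector p u

/-- The weighted direction vector of the edge of `L` containing `p` in its relative interior (unique
up to sign). -/
def edgeVector (L : TropicalCurve l) (p : Fin 2 → ℝ) : Fin 2 → ℤ :=
  if h : L.OnEdge p then h.choose else 0

end TropicalCurve

/-- The intersection multiplicity `(C · L)_x` of a plane tropical curve `C` with the tropical curve `L`
at the image of the marking `x`: the absolute value of the determinant of the weighted
direction vectors of the two edges meeting there. -/
def MarkedGraph.interMultAt {ι : Type} {l : ℕ} (C : MarkedGraph ι) (L : TropicalCurve l) (x : ι) : ℕ :=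
  (cross (L.edgeVector (C.ev x)) (C.edgeDir x)).natAbs

/-! ### The space `M₄` and the forgetful map to it -/

/-- The moduli space of `4`-marked abstract tropical curves: trees with one bounded edge of
given length separating the markings as `12|34`, `13|24` or `14|23` (types (A), (B), (C)), and the
tree with a single vertex (type (D)). -/
inductive M4 : Type
  | typeA (length : ℝ) (pos : 0 < length)
  | typeB (length : ℝ) (pos : 0 < length)
  | typeC (length : ℝ) (pos : 0 < length)
  | typeD

namespace MarkedGraph

variable {ι : Type}

/-- The bounded edge `e` separates the markings `i, j` from the markings `k, m`. -/
def Separates (C : MarkedGraph ι) (e : C.graph.edgeSet) (i j k m : ι) : Prop :=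
  ∃ a b, (e : Sym2 C.V) = s(a, b) ∧ C.OnSide a b (C.mark i) ∧ C.OnSide a b (C.mark j) ∧
    C.OnSide b a (C.mark k) ∧ C.OnSide b a (C.mark m)

/-- The length of a bounded edge. -/
def edgeLen (C : MarkedGraph ι) (e : C.graph.edgeSet) : ℝ :=
  C.len (Quot.out (e : Sym2 C.V)).1 (Quot.out (e : Sym2 C.V)).2

/-- The total length of the bounded edges separating the markings `i, j` from the markings `k, m`. -/
def sepLength (C : MarkedGraph ι) (i j k m : ι) : ℝ :=
  ∑ e with C.Separates e i j k m, C.edgeLen e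

/-- The forgetful map `δ` to `M₄`, for four markings `x 0, x 1, x 2, x 3`: take the minimal
connected subgraph containing these markings and straighten it. If it has a bounded edge, this is
composed of exactly those bounded edges of `C` that separate the four markings into two pairs. -/
def delta (C : MarkedGraph ι) (x : Fin 4 → ι) : M4 :=
  if hA : 0 < C.sepLength (x 0) (x 1) (x 2) (x 3) then .typeA _ hA
  else if hB : 0 < C.sepLength (x 0) (x 2) (x 1) (x 3) then .typeB _ hB
  else if hC : 0 < C.sepLength (x 0) (x 3) (x 1) (x 2) then .typeC _ hC
  else .typeD

end MarkedGraph

/-! ### The map `π̃`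

The markings are indexed by `Fin n`, starting from `0`. -/

/-- The first four of `n ≥ 4` markings. -/
def first4 {n : ℕ} (hn : 4 ≤ n) : Fin 4 → Fin n := Fin.castLE hn

/-- The target `(ℝ²)^(n-2) × M₄` of `π̃`: a point of the plane for every marking except the first two,
and a point of `M₄`. -/
abbrev Target (n : ℕ) : Type := ({i : Fin n // 2 ≤ i.val} → Fin 2 → ℝ) × M4

namespace MarkedGraph

variable {n l : ℕ}

/-- The domain of `π̃`: plane tropical curves of degree `d` with `n` markings, the first two of which
are mapped to two distinct points of `L`. -/
structure InDomain (C : MarkedGraph (Fin n)) (hn : 4 ≤ n) (d : ℕ) (L : TropicalCurve l) : Prop where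
  isCurve : C.IsPlaneTropicalCurve
  hasDegree : C.HasDegree d
  mem_first : L.Contains (C.ev (first4 hn 0))
  mem_second : L.Contains (C.ev (first4 hn 1))
  ev_ne : C.ev (first4 hn 0) ≠ C.ev (first4 hn 1)

/-- The map `π̃ = ev₃ × ⋯ × evₙ × δ`. -/
def piTilde (C : MarkedGraph (Fin n)) (hn : 4 ≤ n) : Target n :=
  (fun i => C.ev i, C.delta (first4 hn))

/-- `C` is a generic point of the domain of `π̃`, i.e. it lies in the interior of a maximal cell: all
vertices are `3`-valent and the first two markings are mapped to the relative interiors of edges of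
`L`. -/
def IsGeneric (C : MarkedGraph (Fin n)) (hn : 4 ≤ n) (L : TropicalCurve l) : Prop :=
  (∀ v, C.valence v = 3) ∧ L.OnEdge (C.ev (first4 hn 0)) ∧ L.OnEdge (C.ev (first4 hn 1))

/-- The matrix of `π̃` at a generic point `C`, in the coordinates of the cell of `C`. The condition that
the first two markings lie on `L` is recorded by one row each, the local equation
`cross u (·) = const` of `L` at the image point, where `u` is the weighted direction vector of the
edge of `L`. There are two rows for each of the other markings. The last row
is the length coordinate of `M₄`. -/
def piMatrix (C : MarkedGraph (Fin n)) (hn : 4 ≤ n) (L : TropicalCurve l) (r : C.V) :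
    Matrix (Fin 2 ⊕ ({i : Fin n // 2 ≤ i.val} × Fin 2) ⊕ Unit) (Fin 2 ⊕ C.graph.edgeSet) ℤ
  | .inl k, c =>
      let x : Fin n := first4 hn (Fin.castLE (by norm_num) k)
      cross (L.edgeVector (C.ev x)) (C.evCoeff r (C.mark x) c)
  | .inr (.inl i), c => C.evCoeff r (C.mark i.1) c i.2
  | .inr (.inr _), .inl _ => 0
  | .inr (.inr _), .inr e =>
      let x := first4 hn
      if C.Separates e (x 0) (x 1) (x 2) (x 3) ∨ C.Separates e (x 0) (x 2) (x 1) (x 3) ∨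
        C.Separates e (x 0) (x 3) (x 1) (x 2) then 1 else 0

/-- The multiplicity of `π̃` at `C`. It does not depend on the root vertex. -/
def piMult (C : MarkedGraph (Fin n)) (hn : 4 ≤ n) (L : TropicalCurve l) : ℕ :=
  if h : Nonempty C.V then absDet (C.piMatrix hn L h.some) else 0

/-- The contracted bounded edge `E = ab` splits `C` into a curve `C₁` of degree `d₁`
(the side of `a`) and a curve `C₂` of degree `d₂` (the side of `b`), such that the markings
`x₁, x₃` are on `C₁`, the markings `x₂, x₄` are on `C₂`, and exactly `3 d₁ - 2` of the
other markings are on `C₁` (hence `3 d₂ - 2` on `C₂`, as `n = 3 (d₁ + d₂)` is the number of markings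
in the case of interest). -/
structure SplitsAt (C : MarkedGraph (Fin n)) (hn : 4 ≤ n) (a b : C.V) (d₁ d₂ : ℕ) : Prop where
  adj : C.graph.Adj a b
  contracted : C.dir a b = 0
  degree_left : (C.side a b).HasDegree d₁
  degree_right : (C.side b a).HasDegree d₂
  left_pos : 0 < d₁
  right_pos : 0 < d₂
  x1 : C.OnSide a b (C.mark (first4 hn 0))
  x3 : C.OnSide a b (C.mark (first4 hn 2))
  x2 : C.OnSide b a (C.mark (first4 hn 1))
  x4 : C.OnSide b a (C.mark (first4 hn 3))
  others : Nat.card {i : Fin n // 4 ≤ i.val ∧ C.OnSide a b (C.mark i)} = 3 * d₁ - 2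

/-- For a curve on one side of a split edge: the multiplicity of the product of evaluations at its
markings except the marking `x` and the new marking `none`, i.e. of `ev` at the curve obtained by
forgetting these two markings. -/
def sideEvMult (C : MarkedGraph (Fin n)) (a b : C.V) (x : Fin n) (hx : C.OnSide a b (C.mark x)) : ℕ :=
  (((C.side a b).forget none).forget ⟨some ⟨x, hx⟩, Option.some_ne_none _⟩).evMult

end MarkedGraph

/-- `Q` is in `π̃`-general position: it lies in the interior of a maximal cell of the target, and all its
inverse images under `π̃` are generic points of the domain. -/
def InGeneralPosition {n l : ℕ} (hn : 4 ≤ n) (d : ℕ) (L : TropicalCurve l) (Q : Target n) : Prop :=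
  Q.2 ≠ M4.typeD ∧
    ∀ C : MarkedGraph (Fin n), C.InDomain hn d L → C.piTilde hn = Q → C.IsGeneric hn L

end

end TropicalTangency

open TropicalTangency

/-!
The integral deformations of a curve `C` (moving the vertices so that every bounded edge keeps its
direction) form a lattice on which the position of a root vertex and the lengths of the bounded
edges are coordinates, so a multiplicity is the absolute determinant of a family of linear forms on
this lattice and may be computed in any basis.

Cut `C` at the contracted edge `E = ab`. Deformations of the two sides together with a length of `E`
are the same as deformations of `C` together with a translation of the second side. Since `E` is
contracted, the translation is the displacement of `Q` relative to `P`. As `E` separates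
`x₁, x₃` from `x₂, x₄`, its length enters the row of `M₄` with coefficient `1` and splits off the
factor `1`.

On each side, forgetting a marking at a `3`-valent vertex splits off one coordinate, the movement of
the marking along its edge. For the markings `P` and `Q` these two coordinates contribute the
determinant of the directions of the edges through them, for `x₁` and `x₂` they contribute the
intersection multiplicities with `L`. What remains are the evaluation matrices of the two curves
with these markings forgotten.
-/

namespace TropicalTangency

noncomputable section

open scoped Classical

/-! ### Absolute determinants of families of linear forms -/

theorem absDet_eq_natAbs_det {m n : Type} [Fintype m] [Fintype n] (M : Matrix m n ℤ) (e : m ≃ n) :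
    absDet M = (M.submatrix id e).det.natAbs := by
  have h : Nonempty (m ≃ n) := ⟨e⟩
  have hM : M.submatrix id e
      = (M.submatrix id h.some).submatrix id (e.trans h.some.symm) := by
    ext i j
    simp
  rw [absDet, dif_pos h, hM, Matrix.det_permute', Int.natAbs_mul]
  simp

theorem absDet_eq_zero {m n : Type} [Fintype m] [Fintype n] (M : Matrix m n ℤ)
    (h : ¬ Nonempty (m ≃ n)) : absDet M = 0 :=
  dif_neg h

section AbsDetOn

variable {m m' k W W' A A' K : Type} [Fintype m] [Fintype m'] [Fintype k]
  [AddCommGroup W] [AddCommGroup W']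
  [AddCommGroup A] [Module.Free ℤ A] [Module.Finite ℤ A]
  [AddCommGroup A'] [Module.Free ℤ A'] [Module.Finite ℤ A']
  [AddCommGroup K] [Module.Free ℤ K] [Module.Finite ℤ K]

theorem absDet_apply_basis_eq {n n' : Type} [Fintype n] [Fintype n'] (f : m → W →ₗ[ℤ] ℤ)
    (b : Module.Basis n ℤ W) (b' : Module.Basis n' ℤ W) :
    absDet (Matrix.of fun i j => f i (b j)) = absDet (Matrix.of fun i j => f i (b' j)) := by
  have σ : n ≃ n' := b.indexEquiv b'
  by_cases h : Nonempty (m ≃ n)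
  · obtain ⟨e⟩ := h
    rw [absDet_eq_natAbs_det _ e, absDet_eq_natAbs_det _ (e.trans σ)]
    set c := b.reindex e.symm
    set c' := b'.reindex (e.trans σ).symm
    have hM : (Matrix.of fun i j => f i (b j)).submatrix id e
        = LinearMap.toMatrix c (Pi.basisFun ℤ m) (LinearMap.pi f) := by
      ext i j
      simp [c, LinearMap.toMatrix_apply]
    have hM' : (Matrix.of fun i j => f i (b' j)).submatrix id (e.trans σ)
        = LinearMap.toMatrix c' (Pi.basisFun ℤ m) (LinearMap.pi f) := by
      ext i j
      simp [c', LinearMap.toMatrix_apply]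
    have hunit : IsUnit (c.toMatrix c').det := by
      have := c.invertibleToMatrix c'
      exact Matrix.isUnit_det_of_invertible _
    rw [hM, hM', ← linearMap_toMatrix_mul_basis_toMatrix c' c (Pi.basisFun ℤ m),
      Matrix.det_mul, Int.natAbs_mul, Int.isUnit_iff_natAbs_eq.mp hunit, mul_one]
  · rw [absDet_eq_zero _ h, absDet_eq_zero]
    rintro ⟨e⟩
    exact h ⟨e.trans σ.symm⟩

/-- The absolute value of the determinant of a family of linear forms on a finitely generated free
abelian group, in any basis. Like `absDet`, it is `0` if the number of forms differs from the
rank. -/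
def absDetOn [Module.Free ℤ W] [Module.Finite ℤ W] (f : m → W →ₗ[ℤ] ℤ) : ℕ :=
  absDet (Matrix.of fun i j => f i (Module.Free.chooseBasis ℤ W j))

variable [Module.Free ℤ W] [Module.Finite ℤ W] [Module.Free ℤ W'] [Module.Finite ℤ W']

theorem absDetOn_eq_absDet {n : Type} [Fintype n] (f : m → W →ₗ[ℤ] ℤ) (b : Module.Basis n ℤ W) :
    absDetOn f = absDet (Matrix.of fun i j => f i (b j)) :=
  absDet_apply_basis_eq f _ b

theorem absDetOn_comp_equiv (f : m → W' →ₗ[ℤ] ℤ) (e : W ≃ₗ[ℤ] W') :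
    absDetOn (fun i => f i ∘ₗ e.toLinearMap) = absDetOn f := by
  rw [absDetOn_eq_absDet _ ((Module.Free.chooseBasis ℤ W').map e.symm)]
  simp [absDetOn]

theorem absDetOn_reindex (f : m → W →ₗ[ℤ] ℤ) (σ : m' ≃ m) :
    absDetOn (fun i => f (σ i)) = absDetOn f := by
  unfold absDetOn
  set b := Module.Free.chooseBasis ℤ W
  by_cases h : Nonempty (m ≃ Module.Free.ChooseBasisIndex ℤ W)
  · obtain ⟨e⟩ := h
    rw [absDet_eq_natAbs_det _ e, absDet_eq_natAbs_det _ (σ.trans e)]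
    congr 1
    exact Matrix.det_submatrix_equiv_self σ
      ((Matrix.of fun i j => f i (b j)).submatrix id e)
  · rw [absDet_eq_zero _ h, absDet_eq_zero]
    rintro ⟨e⟩
    exact h ⟨σ.symm.trans e⟩

theorem absDetOn_prod (f : m → A →ₗ[ℤ] ℤ) (g : k → A × K →ₗ[ℤ] ℤ)
    (hf : Fintype.card m = Module.finrank ℤ A) :
    absDetOn (Sum.elim (fun i => f i ∘ₗ LinearMap.fst ℤ A K) g)
      = absDetOn f * absDetOn (fun j => g j ∘ₗ LinearMap.inr ℤ A K) := by
  set b := Module.Free.chooseBasis ℤ A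
  set b' := Module.Free.chooseBasis ℤ K
  rw [absDetOn_eq_absDet _ (b.prod b'), absDetOn_eq_absDet _ b, absDetOn_eq_absDet _ b']
  have e : m ≃ Module.Free.ChooseBasisIndex ℤ A := Fintype.equivOfCardEq (by
    rw [hf, Module.finrank_eq_card_chooseBasisIndex])
  by_cases h : Nonempty (k ≃ Module.Free.ChooseBasisIndex ℤ K)
  · obtain ⟨e'⟩ := h
    rw [absDet_eq_natAbs_det _ (e.sumCongr e'), absDet_eq_natAbs_det _ e,
      absDet_eq_natAbs_det _ e', ← Int.natAbs_mul, ← Matrix.det_fromBlocks_zero₁₂ _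
        (Matrix.of fun i j => g i (b (e j), 0))]
    congr 2
    ext i j
    rcases i with i | i <;> rcases j with j | j <;> simp
  · rw [absDet_eq_zero (Matrix.of fun i j => _) h, mul_zero, absDet_eq_zero]
    rintro ⟨e'⟩
    refine h ⟨Fintype.equivOfCardEq ?_⟩
    have hsum := Fintype.card_congr e'
    have hcard := Fintype.card_congr e
    simp only [Fintype.card_sum] at hsum
    omega

theorem absDetOn_eq_mul (e : W ≃ₗ[ℤ] A × K) {F : m ⊕ k → W →ₗ[ℤ] ℤ} {f : m → A →ₗ[ℤ] ℤ}
    {g : k → K →ₗ[ℤ] ℤ} (hf : Fintype.card m = Module.finrank ℤ A)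
    (hFf : ∀ i w, F (.inl i) w = f i (e w).1) (hFg : ∀ j z, F (.inr j) (e.symm (0, z)) = g j z) :
    absDetOn F = absDetOn f * absDetOn g := by
  have hF : (fun i => F i ∘ₗ e.symm.toLinearMap) = Sum.elim
      (fun i => f i ∘ₗ LinearMap.fst ℤ A K) (fun j => F (.inr j) ∘ₗ e.symm.toLinearMap) := by
    ext (i | j) w <;> simp [hFf]
  have hg : g = fun j => (F (.inr j) ∘ₗ e.symm.toLinearMap) ∘ₗ LinearMap.inr ℤ A K := by
    ext j z
    simp [hFg]
  rw [← absDetOn_comp_equiv F e.symm, hF, absDetOn_prod _ _ hf, hg]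

theorem absDetOn_unit (g : Unit → ℤ →ₗ[ℤ] ℤ) : absDetOn g = (g () 1).natAbs := by
  rw [absDetOn_eq_absDet g (Module.Basis.singleton Unit ℤ),
    absDet_eq_natAbs_det _ (Equiv.refl _)]
  convert congrArg Int.natAbs (Matrix.det_unique (n := Unit) _)
  simp

theorem absDetOn_eq_mul_natAbs (e : W ≃ₗ[ℤ] A × ℤ) {F : m ⊕ Unit → W →ₗ[ℤ] ℤ}
    {f : m → A →ₗ[ℤ] ℤ} (hf : Fintype.card m = Module.finrank ℤ A)
    (hFf : ∀ i w, F (.inl i) w = f i (e w).1) :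
    absDetOn F = absDetOn f * (F (.inr ()) (e.symm (0, 1))).natAbs := by
  rw [absDetOn_eq_mul e hf hFf
    (g := fun j => F (.inr j) ∘ₗ e.symm.toLinearMap ∘ₗ LinearMap.inr ℤ A ℤ) (fun _ _ => rfl),
    absDetOn_unit]
  rfl

theorem absDetOn_eq_natAbs_cross (g : Fin 2 → W →ₗ[ℤ] ℤ) (b : Module.Basis (Fin 2) ℤ W) :
    absDetOn g = (cross (fun k => g k (b 0)) (fun k => g k (b 1))).natAbs := by
  rw [absDetOn_eq_absDet g b, absDet_eq_natAbs_det _ (Equiv.refl _)]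
  convert congrArg Int.natAbs (Matrix.det_fin_two _)
  simp [cross, mul_comm]

theorem absDetOn_proj :
    absDetOn (fun k : Fin 2 => (LinearMap.proj k : (Fin 2 → ℤ) →ₗ[ℤ] ℤ)) = 1 := by
  rw [absDetOn_eq_natAbs_cross _ (Pi.basisFun ℤ (Fin 2))]
  simp [cross]

theorem absDetOn_glue (e : W ≃ₗ[ℤ] A × ℤ) (e' : W' ≃ₗ[ℤ] A' × ℤ)
    {f : m → A →ₗ[ℤ] ℤ} {f' : m' → A' →ₗ[ℤ] ℤ}
    (hf : Fintype.card m = Module.finrank ℤ A) (hf' : Fintype.card m' = Module.finrank ℤ A')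
    {p : Fin 2 → W →ₗ[ℤ] ℤ} {p' : Fin 2 → W' →ₗ[ℤ] ℤ}
    {F : (m ⊕ m') ⊕ Fin 2 → W × W' →ₗ[ℤ] ℤ}
    (hFf : ∀ i w, F (.inl (.inl i)) w = f i (e w.1).1)
    (hFf' : ∀ i w, F (.inl (.inr i)) w = f' i (e' w.2).1)
    (hFp : ∀ k w, F (.inr k) w = p' k w.2 - p k w.1) :
    absDetOn F = absDetOn f * absDetOn f' *
      (cross (fun k => p k (e.symm (0, 1))) fun k => p' k (e'.symm (0, 1))).natAbs := by
  let E : (W × W') ≃ₗ[ℤ] (A × A') × (ℤ × ℤ) :=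
    (e.prodCongr e').trans (LinearEquiv.prodProdProdComm ℤ A ℤ A' ℤ)
  have hff' : absDetOn (Sum.elim (fun i => f i ∘ₗ LinearMap.fst ℤ A A')
      fun i => f' i ∘ₗ LinearMap.snd ℤ A A') = absDetOn f * absDetOn f' :=
    absDetOn_eq_mul (LinearEquiv.refl ℤ _) hf (fun _ _ => rfl) (fun _ _ => rfl)
  rw [absDetOn_eq_mul E (f := Sum.elim (fun i => f i ∘ₗ LinearMap.fst ℤ A A')
      fun i => f' i ∘ₗ LinearMap.snd ℤ A A') (by simp [hf, hf']) ?_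
      (g := fun k => F (.inr k) ∘ₗ E.symm.toLinearMap ∘ₗ LinearMap.inr ℤ (A × A') (ℤ × ℤ))
      (fun _ _ => rfl), hff',
    absDetOn_eq_natAbs_cross _ (Module.Basis.finTwoProd ℤ), ← Int.natAbs_neg]
  · have hleft (k : Fin 2) : F (.inr k) (E.symm (0, (1, 0))) = -p k (e.symm (0, 1)) := by
      simp [hFp, E, ← Prod.zero_eq_mk, -Prod.mk_eq_zero]
    have hright (k : Fin 2) : F (.inr k) (E.symm (0, (0, 1))) = p' k (e'.symm (0, 1)) := by
      simp [hFp, E, ← Prod.zero_eq_mk, -Prod.mk_eq_zero]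
    simp only [cross, Module.Basis.finTwoProd_zero, Module.Basis.finTwoProd_one,
      LinearMap.comp_apply, LinearMap.inr_apply, LinearEquiv.coe_coe, hleft, hright]
    ring_nf
  · rintro (i | i) w
    · exact hFf i w
    · exact hFf' i w

end AbsDetOn

namespace MarkedGraph

section Deformations

variable {ι : Type}

/-! ### Sides of a bounded edge of a tree -/

theorem onSide_left (C : MarkedGraph ι) (a b : C.V) : C.OnSide a b a :=
  SimpleGraph.Reachable.refl a

theorem onSide_iff_of_adj (C : MarkedGraph ι) (a b : C.V) {s t : C.V} (h : C.graph.Adj s t)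
    (hne : s(s, t) ≠ s(a, b)) : C.OnSide a b s ↔ C.OnSide a b t := by
  have hadj : (C.graph.deleteEdges {s(a, b)}).Adj s t :=
    SimpleGraph.deleteEdges_adj.mpr ⟨h, hne⟩
  exact ⟨fun hs => hs.trans hadj.reachable, fun ht => ht.trans hadj.symm.reachable⟩

theorem not_onSide_right {C : MarkedGraph ι} (hT : C.graph.IsTree) {a b : C.V}
    (h : C.graph.Adj a b) : ¬ C.OnSide a b b :=
  SimpleGraph.isBridge_iff.mp (SimpleGraph.isAcyclic_iff_forall_adj_isBridge.mp hT.isAcyclic h)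

theorem forall_of_forall_adj {V : Type} {G : SimpleGraph V} (hG : G.Preconnected) {P : V → Prop}
    (hP : ∀ s t, G.Adj s t → P s → P t) {r : V} (hr : P r) (v : V) : P v := by
  obtain ⟨p⟩ := hG r v
  induction p with
  | nil => exact hr
  | cons h _ ih => exact ih (hP _ _ h hr)

theorem onSide_or_onSide {C : MarkedGraph ι} (hT : C.graph.IsTree) (a b v : C.V) :
    C.OnSide a b v ∨ C.OnSide b a v := by
  refine forall_of_forall_adj (P := fun v => C.OnSide a b v ∨ C.OnSide b a v)
    hT.connected.preconnected (fun s t hst hs => ?_) (Or.inl (C.onSide_left a b)) v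
  by_cases he : s(s, t) = s(a, b)
  · rcases Sym2.eq_iff.mp he with ⟨rfl, rfl⟩ | ⟨rfl, rfl⟩
    · exact Or.inr (C.onSide_left _ _)
    · exact Or.inl (C.onSide_left _ _)
  · rwa [← C.onSide_iff_of_adj a b hst he,
      ← C.onSide_iff_of_adj b a hst (by rwa [Sym2.eq_swap (a := b)])]

theorem onSide_symm_iff_not {C : MarkedGraph ι} (hT : C.graph.IsTree) {a b : C.V}
    (h : C.graph.Adj a b) (v : C.V) : C.OnSide b a v ↔ ¬ C.OnSide a b v := by
  refine ⟨fun hb ha => not_onSide_right hT h (SimpleGraph.Reachable.trans ha ?_),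
    (onSide_or_onSide hT a b v).resolve_left⟩
  rw [Sym2.eq_swap]
  exact hb.symm

/-! ### Deformations and their coordinates -/

/-- The part of the definition of a plane tropical curve that makes the cell of `C` parametrized by
the root position and the edge lengths: a tree whose bounded edges have opposite direction vectors
at their two vertices. -/
structure IsAffineTree (C : MarkedGraph ι) : Prop where
  isTree : C.graph.IsTree
  dir_symm : ∀ a b, C.graph.Adj a b → C.dir b a = - C.dir a b

theorem lengthCoeff_mk (C : MarkedGraph ι) (r t : C.V) {a b : C.V} (h : C.graph.Adj a b) :
    C.lengthCoeff r t ⟨s(a, b), h⟩ =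
      (if C.OnSide a b r ∧ C.OnSide b a t then C.dir a b else 0) +
        (if C.OnSide b a r ∧ C.OnSide a b t then C.dir b a else 0) := by
  rw [lengthCoeff, Finset.sum_filter,
    ← Finset.sum_subset (Finset.subset_univ {(a, b), (b, a)}), Finset.sum_pair]
  · simp [Sym2.eq_swap]
  · intro hab
    exact h.ne (Prod.ext_iff.mp hab).1
  · rintro ⟨p, q⟩ - hpq
    refine if_neg ?_
    rintro ⟨he, -⟩
    rcases Sym2.eq_iff.mp he with ⟨rfl, rfl⟩ | ⟨rfl, rfl⟩ <;> simp at hpq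

theorem lengthCoeff_of_adj {C : MarkedGraph ι} (hC : C.IsAffineTree) (r : C.V) {s t : C.V}
    (h : C.graph.Adj s t) (e : C.graph.edgeSet) :
    C.lengthCoeff r t e
      = C.lengthCoeff r s e + if (e : Sym2 C.V) = s(s, t) then C.dir s t else 0 := by
  obtain ⟨e, he⟩ := e
  by_cases hst : e = s(s, t)
  · subst hst
    have hs := onSide_symm_iff_not hC.isTree h s
    have ht := onSide_symm_iff_not hC.isTree h t
    have hr := onSide_symm_iff_not hC.isTree h r
    simp only [C.onSide_left, not_true, iff_false, true_iff] at hs ht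
    rw [C.lengthCoeff_mk r t h, C.lengthCoeff_mk r s h]
    by_cases hr' : C.OnSide s t r <;> simp [C.onSide_left, hs, ht, hr, hr', hC.dir_symm s t h]
  · induction e using Sym2.ind with
    | _ a b =>
      have hab := C.onSide_iff_of_adj a b h (Ne.symm hst)
      have hba := C.onSide_iff_of_adj b a h (by rw [Sym2.eq_swap (a := b)]; exact Ne.symm hst)
      rw [C.lengthCoeff_mk r t he, C.lengthCoeff_mk r s he, hab, hba]
      simp [hst]

theorem lengthCoeff_self {C : MarkedGraph ι} (hT : C.graph.IsTree) (r : C.V)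
    (e : C.graph.edgeSet) : C.lengthCoeff r r e = 0 := by
  obtain ⟨e, he⟩ := e
  induction e using Sym2.ind with
  | _ a b => simp [C.lengthCoeff_mk r r he, onSide_symm_iff_not hT he]

theorem sum_mul_evCoeff_of_adj {C : MarkedGraph ι} (hC : C.IsAffineTree) (r : C.V) {s t : C.V}
    (h : C.graph.Adj s t) (c : Fin 2 ⊕ C.graph.edgeSet → ℤ) (k : Fin 2) :
    ∑ i, c i * C.evCoeff r t i k
      = ∑ i, c i * C.evCoeff r s i k + c (.inr ⟨s(s, t), h⟩) * C.dir s t k := by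
  have hsum : ∑ e : C.graph.edgeSet, c (.inr e) *
      (if (e : Sym2 C.V) = s(s, t) then C.dir s t else 0) k
      = c (.inr ⟨s(s, t), h⟩) * C.dir s t k := by
    rw [Finset.sum_eq_single ⟨s(s, t), h⟩ (fun e _ he => ?_) (by simp), if_pos rfl]
    rw [if_neg fun he' => he (Subtype.ext he'), Pi.zero_apply, mul_zero]
  simp only [Fintype.sum_sum_type, evCoeff, lengthCoeff_of_adj hC r h, Pi.add_apply, mul_add,
    Finset.sum_add_distrib, hsum, add_assoc]

theorem sum_mul_evCoeff_self {C : MarkedGraph ι} (hT : C.graph.IsTree) (r : C.V)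
    (c : Fin 2 ⊕ C.graph.edgeSet → ℤ) (k : Fin 2) :
    ∑ i, c i * C.evCoeff r r i k = c (.inl k) := by
  simp [Fintype.sum_sum_type, evCoeff, lengthCoeff_self hT, Pi.single_apply]

/-- The integral points of the linear span of the cell of `C`: pairs of a position for every vertex
and a length for every bounded edge that are compatible with the direction vectors of `C`. The
length function takes two adjacent vertices and is `0` on all other pairs. -/
def deformations (C : MarkedGraph ι) : Submodule ℤ ((C.V → Fin 2 → ℤ) × (C.V → C.V → ℤ)) where
  carrier := {w | (∀ s t, w.2 s t = w.2 t s) ∧ (∀ s t, ¬ C.graph.Adj s t → w.2 s t = 0) ∧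
    ∀ s t, C.graph.Adj s t → ∀ k, w.1 t k = w.1 s k + w.2 s t * C.dir s t k}
  add_mem' := by
    rintro x y ⟨hx, hx', hx''⟩ ⟨hy, hy', hy''⟩
    refine ⟨fun s t => ?_, fun s t h => ?_, fun s t h k => ?_⟩
    · simp [hx s t, hy s t]
    · simp [hx' s t h, hy' s t h]
    · simp only [Prod.fst_add, Pi.add_apply, Prod.snd_add, hx'' s t h k, hy'' s t h k]
      ring
  zero_mem' := by simp
  smul_mem' := by
    rintro c x ⟨hx, hx', hx''⟩
    refine ⟨fun s t => ?_, fun s t h => ?_, fun s t h k => ?_⟩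
    · simp [hx s t]
    · simp [hx' s t h]
    · simp only [Prod.smul_fst, Pi.smul_apply, Prod.smul_snd, hx'' s t h k, smul_eq_mul]
      ring

/-- The `k`-th coordinate of the vertex `t`, as a linear form on deformations. -/
def position (C : MarkedGraph ι) (t : C.V) (k : Fin 2) : C.deformations →ₗ[ℤ] ℤ where
  toFun D := D.1.1 t k
  map_add' _ _ := rfl
  map_smul' _ _ := rfl

/-- The length of a bounded edge, as a linear form on deformations. -/
def edgeLength (C : MarkedGraph ι) (s t : C.V) : C.deformations →ₗ[ℤ] ℤ where
  toFun D := D.1.2 s t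
  map_add' _ _ := rfl
  map_smul' _ _ := rfl

theorem edgeLength_symm (C : MarkedGraph ι) (s t : C.V) (D : C.deformations) :
    C.edgeLength t s D = C.edgeLength s t D :=
  D.2.1 t s

theorem position_of_adj (C : MarkedGraph ι) {s t : C.V} (h : C.graph.Adj s t) (k : Fin 2)
    (D : C.deformations) :
    C.position t k D = C.position s k D + C.edgeLength s t D * C.dir s t k :=
  D.2.2.2 s t h k

/-- The coordinates of a deformation: the position of the vertex `r` and the lengths of the bounded
edges. -/
def coordMap (C : MarkedGraph ι) (r : C.V) :
    C.deformations →ₗ[ℤ] (Fin 2 ⊕ C.graph.edgeSet → ℤ) :=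
  LinearMap.pi (Sum.elim (C.position r)
    fun e => C.edgeLength (Quot.out (e : Sym2 C.V)).1 (Quot.out (e : Sym2 C.V)).2)

theorem apply_out_mk {V : Type} {l : V → V → ℤ} (hl : ∀ s t, l s t = l t s) (s t : V) :
    l (Quot.out s(s, t)).1 (Quot.out s(s, t)).2 = l s t := by
  have hout : s((Quot.out s(s, t)).1, (Quot.out s(s, t)).2) = s(s, t) := Quot.out_eq s(s, t)
  rcases Sym2.eq_iff.mp hout with ⟨hs, ht⟩ | ⟨hs, ht⟩
  · rw [hs, ht]
  · rw [hs, ht, hl]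

theorem coordMap_inr (C : MarkedGraph ι) (r : C.V) {s t : C.V} (h : C.graph.Adj s t)
    (D : C.deformations) : C.coordMap r D (.inr ⟨s(s, t), h⟩) = C.edgeLength s t D :=
  apply_out_mk D.2.1 s t

theorem position_eq_sum {C : MarkedGraph ι} (hC : C.IsAffineTree) (r t : C.V) (k : Fin 2)
    (D : C.deformations) :
    C.position t k D = ∑ i, C.coordMap r D i * C.evCoeff r t i k := by
  refine forall_of_forall_adj (r := r)
    (P := fun t => C.position t k D = ∑ i, C.coordMap r D i * C.evCoeff r t i k)
    hC.isTree.connected.preconnected (fun s t h hs => ?_) ?_ t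
  · rw [C.position_of_adj h, hs, sum_mul_evCoeff_of_adj hC r h, C.coordMap_inr]
  · rw [sum_mul_evCoeff_self hC.isTree]
    rfl

theorem deformation_ext {C : MarkedGraph ι} (hC : C.IsAffineTree) (r : C.V) {D D' : C.deformations}
    (hpos : ∀ k, C.position r k D = C.position r k D')
    (hlen : ∀ s t, C.graph.Adj s t → C.edgeLength s t D = C.edgeLength s t D') : D = D' := by
  have hcoord : C.coordMap r D = C.coordMap r D' := by
    ext (k | ⟨e, he⟩)
    · exact hpos k
    · induction e using Sym2.ind with
      | _ s t => rw [C.coordMap_inr r he, C.coordMap_inr r he, hlen s t he]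
  refine Subtype.ext (Prod.ext (funext fun t => funext fun k => ?_) (funext₂ fun s t => ?_))
  · have ht := position_eq_sum hC r t k D
    rwa [hcoord, ← position_eq_sum hC r t k D'] at ht
  · by_cases h : C.graph.Adj s t
    · exact hlen s t h
    · rw [D.2.2.1 s t h, D'.2.2.1 s t h]

theorem exists_deformation {C : MarkedGraph ι} (hC : C.IsAffineTree) (r : C.V) (p : Fin 2 → ℤ)
    {l : C.V → C.V → ℤ} (hl : ∀ s t, l s t = l t s) :
    ∃ D : C.deformations, (∀ k, C.position r k D = p k) ∧
      ∀ s t, C.graph.Adj s t → C.edgeLength s t D = l s t := by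
  let c : Fin 2 ⊕ C.graph.edgeSet → ℤ := Sum.elim p
    fun e => l (Quot.out (e : Sym2 C.V)).1 (Quot.out (e : Sym2 C.V)).2
  have hc {s t : C.V} (h : C.graph.Adj s t) : c (.inr ⟨s(s, t), h⟩) = l s t := apply_out_mk hl s t
  refine ⟨⟨(fun t k => ∑ i, c i * C.evCoeff r t i k,
    fun s t => if C.graph.Adj s t then l s t else 0), fun s t => ?_, fun s t h => if_neg h,
    fun s t h k => ?_⟩, fun k => sum_mul_evCoeff_self hC.isTree r c k, fun s t h => if_pos h⟩
  · simp only [C.graph.adj_comm t s, hl t s]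
  · simp only [sum_mul_evCoeff_of_adj hC r h, hc, if_pos h]

theorem coordMap_bijective {C : MarkedGraph ι} (hC : C.IsAffineTree) (r : C.V) :
    Function.Bijective (C.coordMap r) := by
  refine ⟨fun D D' h => deformation_ext hC r (fun k => congrFun h (.inl k)) fun s t hst => ?_,
    fun c => ?_⟩
  · rw [← C.coordMap_inr r hst, ← C.coordMap_inr r hst, h]
  · obtain ⟨D, hpos, hlen⟩ := exists_deformation hC r (fun k => c (.inl k))
      (l := fun s t => if h : C.graph.Adj s t then c (.inr ⟨s(s, t), h⟩) else 0) fun s t => by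
        simp only [C.graph.adj_comm s t, Sym2.eq_swap (a := s)]
    refine ⟨D, funext ?_⟩
    rintro (k | ⟨e, he⟩)
    · exact hpos k
    · induction e using Sym2.ind with
      | _ s t =>
        rw [C.coordMap_inr r he, hlen s t he]
        exact dif_pos he

/-- The basis of the lattice of deformations dual to `coordMap`. -/
def coordBasis {C : MarkedGraph ι} (hC : C.IsAffineTree) (r : C.V) :
    Module.Basis (Fin 2 ⊕ C.graph.edgeSet) ℤ C.deformations :=
  .ofEquivFun (LinearEquiv.ofBijective (C.coordMap r) (coordMap_bijective hC r))

theorem coordMap_coordBasis {C : MarkedGraph ι} (hC : C.IsAffineTree) (r : C.V)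
    (i : Fin 2 ⊕ C.graph.edgeSet) : C.coordMap r (coordBasis hC r i) = Pi.single i 1 := by
  rw [coordBasis, Module.Basis.coe_ofEquivFun]
  exact LinearEquiv.apply_symm_apply
    (LinearEquiv.ofBijective (C.coordMap r) (coordMap_bijective hC r)) _

theorem position_coordBasis {C : MarkedGraph ι} (hC : C.IsAffineTree) (r t : C.V) (k : Fin 2)
    (i : Fin 2 ⊕ C.graph.edgeSet) :
    C.position t k (coordBasis hC r i) = C.evCoeff r t i k := by
  simp [position_eq_sum hC r, coordMap_coordBasis, Pi.single_apply]

theorem finrank_deformations {C : MarkedGraph ι} (hC : C.IsAffineTree) :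
    Module.finrank ℤ C.deformations = Fintype.card C.V + 1 := by
  obtain ⟨r⟩ := hC.isTree.connected.nonempty
  have hcard := hC.isTree.card_edgeFinset
  rw [SimpleGraph.edgeFinset_card] at hcard
  rw [Module.finrank_eq_card_basis (coordBasis hC r), Fintype.card_sum, Fintype.card_fin, ← hcard]
  ring

theorem evMult_eq_absDetOn [Fintype ι] {C : MarkedGraph ι} (hC : C.IsAffineTree) :
    C.evMult = absDetOn fun i : ι × Fin 2 => C.position (C.mark i.1) i.2 := by
  have h := hC.isTree.connected.nonempty
  rw [evMult, dif_pos h, absDetOn_eq_absDet _ (coordBasis hC h.some)]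
  congr 1
  ext i c
  exact (position_coordBasis hC _ _ _ _).symm

end Deformations

/-! ### Flags -/

section Flags

variable {ι κ : Type}

/-- The possible flags at a vertex: a bounded edge, represented by its other vertex, an end, or a
marking. -/
abbrev Flag (C : MarkedGraph ι) : Type := C.V ⊕ C.ends ⊕ ι

/-- The flag `f` is attached at `v`. -/
def IsFlag (C : MarkedGraph ι) (v : C.V) : C.Flag → Prop
  | .inl w => C.graph.Adj v w
  | .inr (.inl e) => C.endAt e = v
  | .inr (.inr i) => C.mark i = v

/-- The direction vector of a flag at `v`. -/
def flagDir (C : MarkedGraph ι) (v : C.V) : C.Flag → Fin 2 → ℤ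
  | .inl w => C.dir v w
  | .inr (.inl e) => C.endDir e
  | .inr (.inr _) => 0

theorem isFlagDir_iff_exists_isFlag (C : MarkedGraph ι) (v : C.V) {u : Fin 2 → ℤ} (hu : u ≠ 0) :
    C.IsFlagDir v u ↔ ∃ f, C.IsFlag v f ∧ C.flagDir v f = u := by
  constructor
  · rintro (⟨w, h⟩ | ⟨e, h⟩)
    · exact ⟨.inl w, h⟩
    · exact ⟨.inr (.inl e), h⟩
  · rintro ⟨w | e | i, h⟩
    · exact Or.inl ⟨w, h⟩
    · exact Or.inr ⟨e, h⟩
    · exact absurd h.2.symm hu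

variable [Fintype ι]

/-- The set of flags at a vertex. -/
def flags (C : MarkedGraph ι) (v : C.V) : Finset C.Flag := {f | C.IsFlag v f}

@[simp]
theorem mem_flags (C : MarkedGraph ι) (v : C.V) (f : C.Flag) : f ∈ C.flags v ↔ C.IsFlag v f := by
  simp [flags]

/-- The direction vectors of the flags at a vertex, with multiplicities. -/
def flagDirs (C : MarkedGraph ι) (v : C.V) : Multiset (Fin 2 → ℤ) :=
  (C.flags v).val.map (C.flagDir v)

theorem card_flagDirs (C : MarkedGraph ι) (v : C.V) : (C.flagDirs v).card = C.valence v := by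
  rw [flagDirs, Multiset.card_map, Finset.card_val, flags, ← Fintype.card_subtype,
    ← Nat.card_eq_fintype_card, Nat.card_congr Equiv.subtypeSum, Nat.card_sum,
    Nat.card_congr (Equiv.subtypeSum (p := fun f => C.IsFlag v (.inr f))), Nat.card_sum,
    ← add_assoc]
  rfl

theorem sum_flagDirs (C : MarkedGraph ι) (v : C.V) :
    (C.flagDirs v).sum
      = (∑ w with C.graph.Adj v w, C.dir v w) + ∑ e with C.endAt e = v, C.endDir e := by
  change ∑ f ∈ C.flags v, C.flagDir v f = _
  rw [flags, Finset.sum_filter, Finset.sum_filter, Finset.sum_filter, Fintype.sum_sum_type,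
    Fintype.sum_sum_type]
  simp only [IsFlag, flagDir]
  congr 1
  exact add_eq_left.mpr (Finset.sum_eq_zero fun i _ => ite_self _)

theorem isFlagDir_iff_mem_flagDirs (C : MarkedGraph ι) (v : C.V) {u : Fin 2 → ℤ} (hu : u ≠ 0) :
    C.IsFlagDir v u ↔ u ∈ C.flagDirs v := by
  simp [C.isFlagDir_iff_exists_isFlag v hu, flagDirs]

theorem flagDirs_eq_map {C : MarkedGraph κ} {C' : MarkedGraph ι} {v' : C'.V}
    {φ : C'.Flag → C.Flag} (hφ : Function.Injective φ) {s : Finset C.Flag}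
    (hs : ∀ f, C'.IsFlag v' f ↔ φ f ∈ s) (hsurj : ∀ g ∈ s, ∃ f, φ f = g)
    {δ : C.Flag → Fin 2 → ℤ} (hδ : ∀ f, C'.IsFlag v' f → C'.flagDir v' f = δ (φ f)) :
    C'.flagDirs v' = s.val.map δ := by
  have hmap : s = (C'.flags v').map ⟨φ, hφ⟩ := by
    ext g
    simp only [Finset.mem_map, mem_flags, Function.Embedding.coeFn_mk, hs]
    refine ⟨fun hg => ?_, by rintro ⟨f, hf, rfl⟩; exact hf⟩
    obtain ⟨f, rfl⟩ := hsurj g hg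
    exact ⟨f, hg, rfl⟩
  rw [hmap, Finset.map_val, Multiset.map_map, flagDirs]
  exact Multiset.map_congr rfl fun f hf => hδ f ((C'.mem_flags v' f).mp hf)

theorem edgeDir_congr [Fintype κ] {C : MarkedGraph ι} {C' : MarkedGraph κ} {x : ι} {x' : κ}
    (h : C'.flagDirs (C'.mark x') = C.flagDirs (C.mark x)) : C'.edgeDir x' = C.edgeDir x := by
  have hdir : (fun u => u ≠ 0 ∧ C'.IsFlagDir (C'.mark x') u)
      = fun u => u ≠ 0 ∧ C.IsFlagDir (C.mark x) u := by
    funext u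
    refine propext (and_congr_right fun hu => ?_)
    rw [C'.isFlagDir_iff_mem_flagDirs _ hu, C.isFlagDir_iff_mem_flagDirs _ hu, h]
  unfold edgeDir
  simp only [hdir]

theorem edgeDir_eq_zero_or_mem (C : MarkedGraph ι) (x : ι) :
    C.edgeDir x = 0 ∨ C.edgeDir x ∈ C.flagDirs (C.mark x) := by
  by_cases h : ∃ u, u ≠ 0 ∧ C.IsFlagDir (C.mark x) u
  · rw [edgeDir, dif_pos h]
    exact Or.inr ((C.isFlagDir_iff_mem_flagDirs _ h.choose_spec.1).mp h.choose_spec.2)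
  · exact Or.inl (dif_neg h)

theorem edgeDir_ne_zero {C : MarkedGraph ι} {x : ι} {u : Fin 2 → ℤ} (hu : u ≠ 0)
    (hmem : u ∈ C.flagDirs (C.mark x)) : C.edgeDir x ≠ 0 := by
  have h : ∃ u, u ≠ 0 ∧ C.IsFlagDir (C.mark x) u :=
    ⟨u, hu, (C.isFlagDir_iff_mem_flagDirs _ hu).mpr hmem⟩
  rw [edgeDir, dif_pos h]
  exact h.choose_spec.1

/-- A tree all of whose vertices are `3`-valent, with a balanced map to the plane: what remains of a
`3`-valent plane tropical curve when its lengths and positions are disregarded. -/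
structure IsTrivalent (C : MarkedGraph ι) : Prop extends C.IsAffineTree where
  card_eq : ∀ v, (C.flagDirs v).card = 3
  sum_eq : ∀ v, (C.flagDirs v).sum = 0

theorem IsPlaneTropicalCurve.isTrivalent {C : MarkedGraph ι} (hC : C.IsPlaneTropicalCurve)
    (h : ∀ v, C.valence v = 3) : C.IsTrivalent where
  isTree := hC.isTree
  dir_symm := hC.dir_symm
  card_eq v := (C.card_flagDirs v).trans (h v)
  sum_eq v := (C.sum_flagDirs v).trans (hC.balanced v)

theorem IsTrivalent.card_vertices {C : MarkedGraph ι} (hC : C.IsTrivalent) :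
    Fintype.card C.V + 2 = Fintype.card C.ends + Fintype.card ι := by
  have hflags : ∑ v, (C.flagDirs v).card = 3 * Fintype.card C.V := by
    simp [hC.card_eq, mul_comm]
  have hvalence (v : C.V) : (C.flagDirs v).card = C.graph.degree v
      + Fintype.card {e // C.endAt e = v} + Fintype.card {i // C.mark i = v} := by
    rw [C.card_flagDirs, valence, Nat.card_eq_fintype_card, Nat.card_eq_fintype_card,
      Nat.card_eq_fintype_card, ← SimpleGraph.card_neighborSet_eq_degree]
    congr 2
  simp_rw [hvalence, Finset.sum_add_distrib, ← Fintype.card_sigma] at hflags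
  rw [Fintype.card_congr (Equiv.sigmaFiberEquiv C.endAt),
    Fintype.card_congr (Equiv.sigmaFiberEquiv C.mark)] at hflags
  have hdegree := C.graph.sum_degrees_eq_twice_card_edges
  have hedges := hC.isTree.card_edgeFinset
  omega

theorem IsTrivalent.finrank_deformations {C : MarkedGraph ι} (hC : C.IsTrivalent) :
    Module.finrank ℤ C.deformations + 1 = Fintype.card C.ends + Fintype.card ι := by
  rw [MarkedGraph.finrank_deformations hC.toIsAffineTree, ← hC.card_vertices]

end Flags

/-! ### Straightening a vertex -/

section StraightVertices

variable {ι : Type}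

theorem not_adj_of_path {C : MarkedGraph ι} (hT : C.graph.IsTree) {s v t : C.V}
    (hs : C.graph.Adj s v) (ht : C.graph.Adj v t) (hst : s ≠ t) : ¬ C.graph.Adj s t := by
  intro h
  have hsv : C.OnSide s v t :=
    (C.onSide_iff_of_adj s v h (by simp [ht.ne', hst.symm])).mp (C.onSide_left s v)
  exact not_onSide_right hT hs ((C.onSide_iff_of_adj s v ht (by simp [hst.symm, hs.ne'])).mpr hsv)

theorem not_isFlag_of_isFlag {C : MarkedGraph ι} (hT : C.graph.IsTree) {u v : C.V}
    (hu : C.graph.Adj v u) {f : C.Flag} (hf : C.IsFlag v f) (hne : f ≠ .inl u) :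
    ¬ C.IsFlag u f := by
  rcases f with s | e | i
  · exact not_adj_of_path hT hu.symm hf fun h => hne (congrArg _ h.symm)
  · exact fun h => hu.ne (Eq.trans hf.symm h)
  · exact fun h => hu.ne (Eq.trans hf.symm h)

/-- The vertex `v` lies in the interior of an edge: it has exactly two flags, with opposite
directions. -/
structure IsStraightAt [Fintype ι] (C : MarkedGraph ι) (v : C.V) : Prop where
  card_eq : (C.flagDirs v).card = 2
  sum_eq : (C.flagDirs v).sum = 0

namespace IsStraightAt

variable [Fintype ι] {C : MarkedGraph ι} {v : C.V}

theorem exists_other (h : C.IsStraightAt v) {f : C.Flag} (hf : C.IsFlag v f) :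
    ∃ g, g ≠ f ∧ (∀ f', C.IsFlag v f' ↔ f' = f ∨ f' = g) ∧ C.flagDir v g = - C.flagDir v f := by
  obtain ⟨f₁, f₂, hne, hflags⟩ :=
    Finset.card_eq_two.mp ((Multiset.card_map _ _).symm.trans h.card_eq : (C.flags v).card = 2)
  have hmem (f' : C.Flag) : C.IsFlag v f' ↔ f' = f₁ ∨ f' = f₂ := by
    rw [← C.mem_flags, hflags, Finset.mem_insert, Finset.mem_singleton]
  have hsum : C.flagDir v f₁ + C.flagDir v f₂ = 0 := by
    rw [← Finset.sum_pair hne, ← hflags]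
    exact h.sum_eq
  rcases (hmem f).mp hf with rfl | rfl
  · exact ⟨f₂, hne.symm, hmem, eq_neg_of_add_eq_zero_right hsum⟩
  · exact ⟨f₁, hne, fun f' => (hmem f').trans or_comm, eq_neg_of_add_eq_zero_left hsum⟩

theorem eq_or_eq (h : C.IsStraightAt v) {f g f' : C.Flag} (hf : C.IsFlag v f) (hg : C.IsFlag v g)
    (hgf : g ≠ f) (hf' : C.IsFlag v f') : f' = f ∨ f' = g := by
  obtain ⟨g', -, hflag, -⟩ := h.exists_other hf
  obtain rfl := ((hflag g).mp hg).resolve_left hgf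
  exact (hflag f').mp hf'

theorem flagDir_eq_neg (h : C.IsStraightAt v) {f g : C.Flag} (hf : C.IsFlag v f)
    (hg : C.IsFlag v g) (hgf : g ≠ f) : C.flagDir v g = - C.flagDir v f := by
  obtain ⟨g', -, hflag, hdir⟩ := h.exists_other hf
  obtain rfl := ((hflag g).mp hg).resolve_left hgf
  exact hdir

theorem dir_eq_dir (h : C.IsStraightAt v) (hC : C.IsAffineTree) {s t : C.V}
    (hs : C.graph.Adj s v) (ht : C.graph.Adj v t) (hst : s ≠ t) : C.dir v t = C.dir s v := by
  rw [hC.dir_symm v s hs.symm]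
  exact h.flagDir_eq_neg (f := .inl s) (g := .inl t) hs.symm ht (by simpa using hst.symm)

end IsStraightAt

section Straighten

variable {C : MarkedGraph ι} {v w : C.V} (hvw : C.graph.Adj v w)

/-- The map from the vertices of `C` to those of `C.straighten v w` contracting the edge `vw`. -/
def contract (u : C.V) : (C.straighten v w hvw).V := if h : u = v then ⟨w, hvw.ne'⟩ else ⟨u, h⟩

theorem contract_val (u : (C.straighten v w hvw).V) : contract hvw u.1 = u := dif_neg u.2

theorem contract_self : contract hvw v = ⟨w, hvw.ne'⟩ := dif_pos rfl

theorem contract_eq_iff (a : C.V) (u : (C.straighten v w hvw).V) :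
    contract hvw a = u ↔ a = u.1 ∨ a = v ∧ w = u.1 := by
  by_cases h : a = v
  · rw [h, contract_self, or_iff_right u.2.symm, and_iff_right rfl]
    exact Subtype.ext_iff
  · rw [show contract hvw a = ⟨a, h⟩ from dif_neg h, or_iff_left fun h' => h h'.1]
    exact Subtype.ext_iff

theorem straighten_mark (i : ι) :
    (C.straighten v w hvw).mark i = contract hvw (C.mark i) := rfl

theorem straighten_adj (s t : (C.straighten v w hvw).V) : (C.straighten v w hvw).graph.Adj s t ↔
    s ≠ t ∧ (C.graph.Adj s.1 t.1 ∨ C.graph.Adj s.1 v ∧ C.graph.Adj v t.1) := by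
  refine (SimpleGraph.fromRel_adj _ s t).trans (and_congr_right fun _ => ?_)
  rw [C.graph.adj_comm t.1 s.1, C.graph.adj_comm t.1 v, C.graph.adj_comm v s.1]
  tauto

theorem straighten_adj_contract {a b : C.V} (hab : C.graph.Adj a b)
    (hne : contract hvw a ≠ contract hvw b) :
    (C.straighten v w hvw).graph.Adj (contract hvw a) (contract hvw b) := by
  rw [straighten_adj]
  refine ⟨hne, ?_⟩
  by_cases ha : a = v
  · subst ha
    exact Or.inr ⟨by simpa only [contract_self] using hvw.symm,
      by simpa [contract, hab.ne'] using hab⟩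
  · by_cases hb : b = v
    · subst hb
      exact Or.inr ⟨by simpa [contract, ha] using hab, by simpa only [contract_self] using hvw⟩
    · exact Or.inl (by simpa [contract, ha, hb] using hab)

theorem straighten_preconnected (hC : C.graph.Preconnected) :
    (C.straighten v w hvw).graph.Preconnected := by
  intro s t
  rw [← contract_val hvw s, ← contract_val hvw t]
  refine forall_of_forall_adj (r := s.1) (P := fun u =>
    (C.straighten v w hvw).graph.Reachable (contract hvw s.1) (contract hvw u)) hC
    (fun a b hab ha => ha.trans ?_) (SimpleGraph.Reachable.refl _) t.1
  by_cases he : contract hvw a = contract hvw b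
  · rw [he]
  · exact (straighten_adj_contract hvw hab he).reachable

theorem card_straighten_V :
    Fintype.card (C.straighten v w hvw).V + 1 = Fintype.card C.V := by
  have hcard : Fintype.card (C.straighten v w hvw).V = Fintype.card C.V - 1 := by
    rw [← Fintype.card_subtype_eq v, ← Fintype.card_subtype_compl]
    exact Fintype.card_congr (Equiv.refl _)
  have hpos : 0 < Fintype.card C.V := Fintype.card_pos_iff.mpr ⟨v⟩
  omega

theorem straighten_dir_of_adj {s t : (C.straighten v w hvw).V} (h : C.graph.Adj s.1 t.1) :
    (C.straighten v w hvw).dir s t = C.dir s.1 t.1 := if_pos h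

theorem straighten_dir_of_path (hC : C.graph.IsTree) {s t : (C.straighten v w hvw).V}
    (hs : C.graph.Adj s.1 v) (ht : C.graph.Adj v t.1) (hst : s.1 ≠ t.1) :
    (C.straighten v w hvw).dir s t = C.dir s.1 v := if_neg (not_adj_of_path hC hs ht hst)

/-- A flag of `C.straighten v w` as a flag of `C`: the one at the same distant end. -/
def straightenFlag : (C.straighten v w hvw).Flag → C.Flag := Sum.map Subtype.val id

theorem straightenFlag_injective : Function.Injective (straightenFlag hvw) :=
  Sum.map_injective.mpr ⟨Subtype.val_injective, Function.injective_id⟩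

theorem exists_straightenFlag_eq_iff (f : C.Flag) :
    (∃ f', straightenFlag hvw f' = f) ↔ f ≠ .inl v := by
  refine ⟨?_, fun hf => ?_⟩
  · rintro ⟨s | f', rfl⟩
    · exact fun h => s.2 (Sum.inl_injective h)
    · exact Sum.inr_ne_inl
  · rcases f with s | f
    · exact ⟨.inl ⟨s, fun h => hf (congrArg _ h)⟩, rfl⟩
    · exact ⟨.inr f, rfl⟩

theorem straighten_flagDir_of_isFlag {u : (C.straighten v w hvw).V}
    {f : (C.straighten v w hvw).Flag} (h : C.IsFlag u.1 (straightenFlag hvw f)) :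
    (C.straighten v w hvw).flagDir u f = C.flagDir u.1 (straightenFlag hvw f) := by
  rcases f with s | e | i
  · exact straighten_dir_of_adj hvw h
  · rfl
  · rfl

variable [Fintype ι]

theorem exists_adj_of_straighten_adj (hv : C.IsStraightAt v) {s t : (C.straighten v w hvw).V}
    (hst : (C.straighten v w hvw).graph.Adj s t) :
    ∃ a b, C.graph.Adj a b ∧ s(a, b) ≠ s(v, w) ∧ contract hvw a = s ∧ contract hvw b = t := by
  obtain ⟨hne, hadj | ⟨hs, ht⟩⟩ := (straighten_adj hvw s t).mp hst
  · exact ⟨s.1, t.1, hadj, by simp [s.2, t.2], contract_val hvw s, contract_val hvw t⟩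
  · have hne' : s.1 ≠ t.1 := fun h => hne (Subtype.ext h)
    rcases hv.eq_or_eq (f := .inl s.1) (g := .inl t.1) (f' := .inl w) hs.symm ht
      (by simpa using hne'.symm) hvw with h | h
    · have hws : w = s.1 := Sum.inl_injective h
      exact ⟨v, t.1, ht, by simp [hws, hne'.symm, s.2.symm],
        (contract_eq_iff hvw v s).mpr (Or.inr ⟨rfl, hws⟩), contract_val hvw t⟩
    · have hwt : w = t.1 := Sum.inl_injective h
      exact ⟨s.1, v, hs, by simp [hwt, hne', s.2], contract_val hvw s,
        (contract_eq_iff hvw v t).mpr (Or.inr ⟨rfl, hwt⟩)⟩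

theorem straighten_isTree (hC : C.graph.IsTree) (hv : C.IsStraightAt v) :
    (C.straighten v w hvw).graph.IsTree := by
  have hconn : (C.straighten v w hvw).graph.Connected :=
    { preconnected := straighten_preconnected hvw hC.connected.preconnected
      nonempty := ⟨⟨w, hvw.ne'⟩⟩ }
  refine SimpleGraph.isTree_iff_connected_and_card.mpr
    ⟨hconn, le_antisymm ?_ hconn.card_vert_le_card_edgeSet_add_one⟩
  have hsub : (C.straighten v w hvw).graph.edgeFinset
      ⊆ (C.graph.edgeFinset.erase s(v, w)).image (Sym2.map (contract hvw)) := by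
    intro e he
    induction e using Sym2.ind with
    | _ s t =>
      obtain ⟨a, b, hab, hne, rfl, rfl⟩ :=
        exists_adj_of_straighten_adj hvw hv (SimpleGraph.mem_edgeFinset.mp he)
      exact Finset.mem_image.mpr
        ⟨s(a, b), Finset.mem_erase.mpr ⟨hne, SimpleGraph.mem_edgeFinset.mpr hab⟩, rfl⟩
  have hle := (Finset.card_le_card hsub).trans Finset.card_image_le
  have hvw_mem : s(v, w) ∈ C.graph.edgeFinset := SimpleGraph.mem_edgeFinset.mpr hvw
  have hedges := hC.card_edgeFinset
  have hV := card_straighten_V hvw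
  have hpos : 0 < C.graph.edgeFinset.card := Finset.card_pos.mpr ⟨s(v, w), hvw_mem⟩
  rw [Finset.card_erase_of_mem hvw_mem] at hle
  rw [Nat.card_eq_fintype_card, Nat.card_eq_fintype_card, ← SimpleGraph.edgeFinset_card]
  omega

theorem straighten_isAffineTree (hC : C.IsAffineTree) (hv : C.IsStraightAt v) :
    (C.straighten v w hvw).IsAffineTree where
  isTree := straighten_isTree hvw hC.isTree hv
  dir_symm s t hst := by
    obtain ⟨hne, hadj | ⟨hs, ht⟩⟩ := (straighten_adj hvw s t).mp hst
    · rw [straighten_dir_of_adj hvw hadj, straighten_dir_of_adj hvw hadj.symm,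
        hC.dir_symm _ _ hadj]
    · have hne' : s.1 ≠ t.1 := fun h => hne (Subtype.ext h)
      rw [straighten_dir_of_path hvw hC.isTree hs ht hne',
        straighten_dir_of_path hvw hC.isTree ht.symm hs.symm hne'.symm, hC.dir_symm _ _ ht,
        hv.dir_eq_dir hC hs ht hne']

theorem isFlag_straighten_iff (hv : C.IsStraightAt v) (u : (C.straighten v w hvw).V)
    (f : (C.straighten v w hvw).Flag) : (C.straighten v w hvw).IsFlag u f ↔
      C.IsFlag u.1 (straightenFlag hvw f) ∨ C.graph.Adj v u.1 ∧
        C.IsFlag v (straightenFlag hvw f) ∧ straightenFlag hvw f ≠ .inl u.1 := by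
  have hw (x : C.ends ⊕ ι) (hx : C.IsFlag v (.inr x)) : w = u.1 ↔ C.graph.Adj v u.1 := by
    refine ⟨fun h => h ▸ hvw, fun h => ?_⟩
    have := hv.eq_or_eq (f := .inr x) (g := .inl w) (f' := .inl u.1) hx hvw Sum.inl_ne_inr h
    simpa [eq_comm] using this
  rcases f with s | e | i
  · refine (straighten_adj hvw u s).trans ?_
    have hirrefl : C.graph.Adj u.1 s.1 → u ≠ s := fun h h' => h.ne (congrArg _ h')
    have hne : (Sum.inl s.1 : C.Flag) ≠ .inl u.1 ↔ u ≠ s :=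
      (Sum.inl_injective.ne_iff.trans ne_comm).trans (Subtype.val_injective.ne_iff (x := u))
    change _ ↔ C.graph.Adj u.1 s.1 ∨ C.graph.Adj v u.1 ∧ C.graph.Adj v s.1 ∧ _
    rw [C.graph.adj_comm v u.1]
    exact ⟨by tauto, by tauto⟩
  · refine (contract_eq_iff hvw (C.endAt e) u).trans (or_congr_right ?_)
    have h := hw (.inl e)
    have hne : (Sum.inr (.inl e) : C.Flag) ≠ .inl u.1 := Sum.inr_ne_inl
    change C.endAt e = v ∧ w = u.1 ↔ C.graph.Adj v u.1 ∧ C.endAt e = v ∧ _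
    tauto
  · refine (contract_eq_iff hvw (C.mark i) u).trans (or_congr_right ?_)
    have h := hw (.inr i)
    have hne : (Sum.inr (.inr i) : C.Flag) ≠ .inl u.1 := Sum.inr_ne_inl
    change C.mark i = v ∧ w = u.1 ↔ C.graph.Adj v u.1 ∧ C.mark i = v ∧ _
    tauto

theorem straighten_flagDir_of_path (hC : C.IsAffineTree) (hv : C.IsStraightAt v)
    {u : (C.straighten v w hvw).V} (hu : C.graph.Adj v u.1) {f : (C.straighten v w hvw).Flag}
    (hf : C.IsFlag v (straightenFlag hvw f)) (hne : straightenFlag hvw f ≠ .inl u.1) :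
    (C.straighten v w hvw).flagDir u f = C.dir u.1 v := by
  have hdir : C.flagDir v (straightenFlag hvw f) = C.dir u.1 v := by
    rw [hC.dir_symm v u.1 hu]
    exact hv.flagDir_eq_neg (f := .inl u.1) hu hf hne
  rcases f with s | e | i
  · exact straighten_dir_of_path hvw hC.isTree hu.symm hf fun h => hne (congrArg _ h.symm)
  · exact hdir
  · exact hdir

theorem flagDirs_straighten_of_adj (hC : C.IsAffineTree) (hv : C.IsStraightAt v)
    {u : (C.straighten v w hvw).V} (hu : C.graph.Adj v u.1) :
    (C.straighten v w hvw).flagDirs u = C.flagDirs u.1 := by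
  -- the other flag `o` at `v` replaces the edge from `u` to `v`
  obtain ⟨o, hne, hflag, -⟩ := hv.exists_other (f := .inl u.1) hu
  have ho : C.IsFlag v o := (hflag o).mpr (Or.inr rfl)
  have hou : ¬ C.IsFlag u.1 o := not_isFlag_of_isFlag hC.isTree hu ho hne
  have hov (f : (C.straighten v w hvw).Flag) : straightenFlag hvw f ≠ .inl v :=
    (exists_straightenFlag_eq_iff hvw _).mp ⟨f, rfl⟩
  have hiff (f : (C.straighten v w hvw).Flag) : (C.straighten v w hvw).IsFlag u f ↔
      C.IsFlag u.1 (straightenFlag hvw f) ∨ straightenFlag hvw f = o := by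
    rw [isFlag_straighten_iff hvw hv, hflag]
    aesop
  refine flagDirs_eq_map (s := C.flags u.1)
    (φ := fun f => Equiv.swap (.inl v) o (straightenFlag hvw f))
    ((Equiv.injective _).comp (straightenFlag_injective hvw)) (fun f => ?_) (fun g hg => ?_)
    fun f hf => ?_
  · rw [hiff, mem_flags]
    by_cases hfo : straightenFlag hvw f = o
    · rw [hfo, Equiv.swap_apply_right]
      exact iff_of_true (Or.inr rfl) hu.symm
    · rw [Equiv.swap_apply_of_ne_of_ne (hov f) hfo, or_iff_left hfo]
  · obtain ⟨f, hf⟩ := (exists_straightenFlag_eq_iff hvw (Equiv.swap (.inl v) o g)).mpr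
      fun h => hou (((Equiv.swap_apply_eq_iff).mp h).trans (Equiv.swap_apply_left _ _) ▸
        (C.mem_flags _ _).mp hg)
    exact ⟨f, by rw [hf, Equiv.swap_apply_self]⟩
  · by_cases hfo : straightenFlag hvw f = o
    · rw [hfo, Equiv.swap_apply_right]
      exact straighten_flagDir_of_path hvw hC hv hu (hfo ▸ ho) (hfo ▸ hne)
    · rw [Equiv.swap_apply_of_ne_of_ne (hov f) hfo]
      exact straighten_flagDir_of_isFlag hvw (((hiff f).mp hf).resolve_right hfo)

theorem flagDirs_straighten_of_not_adj (hv : C.IsStraightAt v) {u : (C.straighten v w hvw).V}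
    (hu : ¬ C.graph.Adj v u.1) : (C.straighten v w hvw).flagDirs u = C.flagDirs u.1 := by
  have hiff := isFlag_straighten_iff hvw hv u
  simp only [hu, false_and, or_false] at hiff
  refine flagDirs_eq_map (s := C.flags u.1) (straightenFlag_injective hvw)
    (fun f => (hiff f).trans (C.mem_flags _ _).symm) (fun g hg => ?_)
    fun f hf => straighten_flagDir_of_isFlag hvw ((hiff f).mp hf)
  refine (exists_straightenFlag_eq_iff hvw g).mpr ?_
  rintro rfl
  exact hu (C.graph.adj_symm ((C.mem_flags _ _).mp hg))

theorem flagDirs_straighten (hC : C.IsAffineTree) (hv : C.IsStraightAt v)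
    (u : (C.straighten v w hvw).V) : (C.straighten v w hvw).flagDirs u = C.flagDirs u.1 := by
  by_cases hu : C.graph.Adj v u.1
  · exact flagDirs_straighten_of_adj hvw hC hv hu
  · exact flagDirs_straighten_of_not_adj hvw hv hu

end Straighten

end StraightVertices

section StraightenEquiv

variable {ι : Type} {C : MarkedGraph ι} {v w : C.V}

/-- The length of an edge of `C.straighten v w` as a linear form on the deformations of `C`: if the
edge is not an edge of `C`, then it is composed of two edges at `v`. -/
def straightenLength (C : MarkedGraph ι) (v s t : C.V) : C.deformations →ₗ[ℤ] ℤ :=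
  C.edgeLength s t + if C.graph.Adj s v ∧ C.graph.Adj v t ∧ s ≠ t then
    C.edgeLength s v + C.edgeLength v t else 0

theorem straightenLength_of_adj (hT : C.graph.IsTree) {s t : C.V} (h : C.graph.Adj s t) :
    C.straightenLength v s t = C.edgeLength s t := by
  rw [straightenLength, if_neg fun h' => not_adj_of_path hT h'.1 h'.2.1 h'.2.2 h, add_zero]

theorem straightenLength_of_path (hT : C.graph.IsTree) {s t : C.V} (hs : C.graph.Adj s v)
    (ht : C.graph.Adj v t) (hst : s ≠ t) (D : C.deformations) :
    C.straightenLength v s t D = C.edgeLength s v D + C.edgeLength v t D := by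
  rw [straightenLength, if_pos ⟨hs, ht, hst⟩, LinearMap.add_apply,
    show C.edgeLength s t D = 0 from D.2.2.1 s t (not_adj_of_path hT hs ht hst), zero_add]
  rfl

variable [Fintype ι] (hvw : C.graph.Adj v w)

/-- The restriction of deformations of `C` to `C.straighten v w`. -/
def straightenDeformation (hC : C.IsAffineTree) (hv : C.IsStraightAt v) :
    C.deformations →ₗ[ℤ] (C.straighten v w hvw).deformations :=
  LinearMap.codRestrict _
    (LinearMap.prod (LinearMap.pi fun s => LinearMap.pi (C.position s.1))
      (LinearMap.pi fun s => LinearMap.pi fun t => C.straightenLength v s.1 t.1)) fun D => by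
    refine ⟨fun s t => ?_, fun s t h => ?_, fun s t h k => ?_⟩
    · change C.straightenLength v s.1 t.1 D = C.straightenLength v t.1 s.1 D
      have hiff : (C.graph.Adj s.1 v ∧ C.graph.Adj v t.1 ∧ s.1 ≠ t.1)
          ↔ (C.graph.Adj t.1 v ∧ C.graph.Adj v s.1 ∧ t.1 ≠ s.1) := by
        rw [C.graph.adj_comm s.1, C.graph.adj_comm t.1, ne_comm]
        tauto
      simp only [straightenLength, LinearMap.add_apply, hiff]
      rw [C.edgeLength_symm t.1 s.1]
      split_ifs
      · rw [LinearMap.add_apply, LinearMap.add_apply, C.edgeLength_symm v s.1,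
          C.edgeLength_symm t.1 v, add_comm (C.edgeLength v s.1 D)]
      · rfl
    · change C.straightenLength v s.1 t.1 D = 0
      rw [straighten_adj, not_and] at h
      by_cases hst : s = t
      · subst hst
        rw [straightenLength, if_neg fun h' => h'.2.2 rfl, add_zero]
        exact D.2.2.1 s.1 s.1 C.graph.irrefl
      · obtain ⟨hadj, hpath⟩ := not_or.mp (h hst)
        rw [straightenLength, if_neg fun h' => hpath ⟨h'.1, h'.2.1⟩, add_zero]
        exact D.2.2.1 s.1 t.1 hadj
    · change C.position t.1 k D = C.position s.1 k D
        + C.straightenLength v s.1 t.1 D * (C.straighten v w hvw).dir s t k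
      obtain ⟨hne, hadj | ⟨hs, ht⟩⟩ := (straighten_adj hvw s t).mp h
      · rw [straightenLength_of_adj hC.isTree hadj, straighten_dir_of_adj hvw hadj,
          C.position_of_adj hadj]
      · have hne' : s.1 ≠ t.1 := fun h => hne (Subtype.ext h)
        rw [straightenLength_of_path hC.isTree hs ht hne',
          straighten_dir_of_path hvw hC.isTree hs ht hne', C.position_of_adj ht,
          C.position_of_adj hs, hv.dir_eq_dir hC hs ht hne']
        ring

theorem edgeLength_straightenDeformation (hC : C.IsAffineTree) (hv : C.IsStraightAt v)
    (s t : (C.straighten v w hvw).V) (D : C.deformations) :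
    (C.straighten v w hvw).edgeLength s t (straightenDeformation hvw hC hv D)
      = C.straightenLength v s.1 t.1 D := rfl

theorem straightenDeformation_injective (hC : C.IsAffineTree) (hv : C.IsStraightAt v) :
    Function.Injective ((straightenDeformation hvw hC hv).prod (C.edgeLength v w)) := by
  intro D D' h
  obtain ⟨hD, hvw_eq⟩ := Prod.ext_iff.mp h
  have hlen (s t : (C.straighten v w hvw).V) :
      C.straightenLength v s.1 t.1 D = C.straightenLength v s.1 t.1 D' :=
    congrArg ((C.straighten v w hvw).edgeLength s t) hD
  have hlen_v (t : C.V) (ht : C.graph.Adj v t) : C.edgeLength v t D = C.edgeLength v t D' := by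
    by_cases htw : t = w
    · rw [htw]
      exact hvw_eq
    · have hwt := hlen ⟨w, hvw.ne'⟩ ⟨t, ht.ne'⟩
      rw [straightenLength_of_path hC.isTree hvw.symm ht (Ne.symm htw),
        straightenLength_of_path hC.isTree hvw.symm ht (Ne.symm htw), C.edgeLength_symm v w,
        C.edgeLength_symm v w] at hwt
      exact add_left_cancel (hwt.trans (congrArg (· + _) hvw_eq.symm))
  refine deformation_ext hC w
    (fun k => congrArg ((C.straighten v w hvw).position ⟨w, hvw.ne'⟩ k) hD) fun s t hst => ?_
  by_cases hs : s = v
  · subst hs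
    exact hlen_v t hst
  · by_cases ht : t = v
    · subst ht
      rw [C.edgeLength_symm t s, C.edgeLength_symm t s, hlen_v s hst.symm]
    · have := hlen ⟨s, hs⟩ ⟨t, ht⟩
      rwa [straightenLength_of_adj hC.isTree hst] at this

theorem straightenDeformation_surjective (hC : C.IsAffineTree) (hv : C.IsStraightAt v) :
    Function.Surjective ((straightenDeformation hvw hC hv).prod (C.edgeLength v w)) := by
  rintro ⟨D', z⟩
  let l' : C.V → C.V → ℤ := fun s t =>
    (C.straighten v w hvw).edgeLength (contract hvw s) (contract hvw t) D'
  let m : C.V → ℤ := fun t => if t = w then z else l' w t - z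
  obtain ⟨D, hpos, hlen⟩ := exists_deformation hC w
    (fun k => (C.straighten v w hvw).position ⟨w, hvw.ne'⟩ k D')
    (l := fun s t => if s = v then m t else if t = v then m s else l' s t) fun s t => by
      have hl' : l' s t = l' t s := (C.straighten v w hvw).edgeLength_symm _ _ D'
      split_ifs with hs ht <;> simp [*]
  have hlen_v (t : C.V) (ht : C.graph.Adj v t) : C.edgeLength v t D = m t :=
    (hlen v t ht).trans (if_pos rfl)
  have hlen_v' (t : C.V) (ht : C.graph.Adj t v) : C.edgeLength t v D = m t := by
    rw [C.edgeLength_symm v t, hlen_v t ht.symm]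
  have hm : m w = z := if_pos rfl
  refine ⟨D, Prod.ext (deformation_ext (straighten_isAffineTree hvw hC hv) ⟨w, hvw.ne'⟩
    hpos fun s t hst => ?_) ((hlen_v w hvw).trans hm)⟩
  have hl : l' s.1 t.1 = (C.straighten v w hvw).edgeLength s t D' := by
    simp only [l', contract_val]
  refine (edgeLength_straightenDeformation hvw hC hv s t D).trans ?_
  rw [← hl]
  obtain ⟨hne, hadj | ⟨hs, ht⟩⟩ := (straighten_adj hvw s t).mp hst
  · rw [straightenLength_of_adj hC.isTree hadj, hlen _ _ hadj, if_neg s.2, if_neg t.2]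
  · have hne' : s.1 ≠ t.1 := fun h => hne (Subtype.ext h)
    rw [straightenLength_of_path hC.isTree hs ht hne', hlen_v' _ hs, hlen_v _ ht]
    rcases hv.eq_or_eq (f := .inl s.1) (g := .inl t.1) (f' := .inl w) hs.symm ht
      (by simpa using hne'.symm) hvw with h | h
    · have hws : w = s.1 := Sum.inl_injective h
      rw [show m s.1 = z from if_pos hws.symm,
        show m t.1 = l' w t.1 - z from if_neg (hws ▸ hne'.symm), add_sub_cancel, hws]
    · have hwt : w = t.1 := Sum.inl_injective h
      rw [show m t.1 = z from if_pos hwt.symm,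
        show m s.1 = l' w s.1 - z from if_neg (hwt ▸ hne'), sub_add_cancel, hwt]
      exact (C.straighten v w hvw).edgeLength_symm _ _ D'

/-- Straightening a `2`-valent vertex splits off the length of one of the edges at this vertex. -/
def straightenEquiv (hC : C.IsAffineTree) (hv : C.IsStraightAt v) :
    C.deformations ≃ₗ[ℤ] (C.straighten v w hvw).deformations × ℤ :=
  LinearEquiv.ofBijective ((straightenDeformation hvw hC hv).prod (C.edgeLength v w))
    ⟨straightenDeformation_injective hvw hC hv, straightenDeformation_surjective hvw hC hv⟩

theorem position_straightenEquiv (hC : C.IsAffineTree) (hv : C.IsStraightAt v) (i : ι)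
    (k : Fin 2) (D : C.deformations) : (C.straighten v w hvw).position
      ((C.straighten v w hvw).mark i) k (straightenEquiv hvw hC hv D).1
        = C.position (C.mark i) k D := by
  by_cases hi : C.mark i = v
  · have hdir : C.dir v w = -0 :=
      hv.flagDir_eq_neg (f := .inr (.inr i)) (g := .inl w) hi hvw Sum.inl_ne_inr
    rw [straighten_mark, hi, contract_self]
    change C.position w k D = _
    rw [C.position_of_adj hvw, hdir, neg_zero, Pi.zero_apply, mul_zero, add_zero]
  · rw [straighten_mark, show contract hvw (C.mark i) = ⟨C.mark i, hi⟩ from dif_neg hi]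
    rfl

theorem position_straightenEquiv_symm (hC : C.IsAffineTree) (hv : C.IsStraightAt v) (k : Fin 2) :
    C.position v k ((straightenEquiv hvw hC hv).symm (0, 1)) = - C.dir v w k := by
  obtain ⟨hD, hlen⟩ := Prod.ext_iff.mp ((straightenEquiv hvw hC hv).apply_symm_apply (0, 1))
  have hw : C.position w k ((straightenEquiv hvw hC hv).symm (0, 1)) = 0 :=
    congrArg ((C.straighten v w hvw).position ⟨w, hvw.ne'⟩ k) hD
  replace hlen : C.edgeLength v w ((straightenEquiv hvw hC hv).symm (0, 1)) = 1 := hlen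
  rw [C.position_of_adj hvw, hlen, one_mul] at hw
  exact eq_neg_of_add_eq_zero_left hw

end StraightenEquiv

/-! ### Forgetting a marking -/

section Forget

variable {ι : Type} {C : MarkedGraph ι}

theorem IsAffineTree.drop (hC : C.IsAffineTree) (x : ι) : (C.drop x).IsAffineTree where
  isTree := hC.isTree
  dir_symm := hC.dir_symm

variable [Fintype ι]

theorem flagDirs_drop (C : MarkedGraph ι) (x : ι) (v : C.V) : (C.drop x).flagDirs v
    = ((C.flags v).erase (.inr (.inr x))).val.map (C.flagDir v) := by
  let φ : (C.drop x).Flag → C.Flag := Sum.map id (Sum.map id Subtype.val)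
  have hφ : Function.Injective φ := Sum.map_injective.mpr ⟨Function.injective_id,
    Sum.map_injective.mpr ⟨Function.injective_id, Subtype.val_injective⟩⟩
  have hne (f : (C.drop x).Flag) : φ f ≠ .inr (.inr x) := by
    rcases f with s | e | i
    · exact Sum.inl_ne_inr
    · exact fun h => Sum.inl_ne_inr (Sum.inr_injective h)
    · exact fun h => i.2 (Sum.inr_injective (Sum.inr_injective h))
  refine flagDirs_eq_map hφ (fun f => ?_) (fun g hg => ?_) fun f _ => ?_
  · rw [Finset.mem_erase, mem_flags, and_iff_right (hne f)]
    rcases f with s | e | i <;> rfl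
  · rcases g with s | e | i
    · exact ⟨.inl s, rfl⟩
    · exact ⟨.inr (.inl e), rfl⟩
    · exact ⟨.inr (.inr ⟨i, fun h => (Finset.mem_erase.mp hg).1 (by rw [h])⟩), rfl⟩
  · rcases f with s | e | i <;> rfl

theorem flagDirs_drop_of_ne {x : ι} {v : C.V} (h : C.mark x ≠ v) :
    (C.drop x).flagDirs v = C.flagDirs v := by
  rw [flagDirs_drop, Finset.erase_eq_of_notMem]
  · rfl
  · rwa [mem_flags]

theorem flagDirs_mark (C : MarkedGraph ι) (x : ι) :
    C.flagDirs (C.mark x) = 0 ::ₘ (C.drop x).flagDirs (C.mark x) := by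
  have hx : (.inr (.inr x) : C.Flag) ∈ (C.flags (C.mark x)).val := by
    rw [Finset.mem_val, mem_flags]
    rfl
  rw [flagDirs_drop, Finset.erase_val, flagDirs, ← Multiset.cons_erase hx, Multiset.map_cons,
    Multiset.cons_erase hx]
  rfl

theorem IsTrivalent.isStraightAt_drop (hC : C.IsTrivalent) (x : ι) :
    (C.drop x).IsStraightAt (C.mark x) where
  card_eq := by simpa [C.flagDirs_mark] using hC.card_eq (C.mark x)
  sum_eq := by simpa [C.flagDirs_mark] using hC.sum_eq (C.mark x)

theorem IsStraightAt.eq_or_eq_neg {v : C.V} (hv : C.IsStraightAt v) {f : C.Flag}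
    (hf : C.IsFlag v f) {u : Fin 2 → ℤ} (hu : u ∈ C.flagDirs v) :
    u = C.flagDir v f ∨ u = - C.flagDir v f := by
  obtain ⟨g, hg, rfl⟩ := Multiset.mem_map.mp hu
  by_cases hgf : g = f
  · exact Or.inl (by rw [hgf])
  · exact Or.inr (hv.flagDir_eq_neg hf ((C.mem_flags v g).mp hg) hgf)

theorem IsTrivalent.edgeDir_eq_or_eq_neg (hC : C.IsTrivalent) (x : ι) {f : (C.drop x).Flag}
    (hf : (C.drop x).IsFlag (C.mark x) f) :
    C.edgeDir x = (C.drop x).flagDir (C.mark x) f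
      ∨ C.edgeDir x = - (C.drop x).flagDir (C.mark x) f := by
  have hmem : (C.drop x).flagDir (C.mark x) f ∈ C.flagDirs (C.mark x) := by
    rw [C.flagDirs_mark]
    exact Multiset.mem_cons_of_mem (Multiset.mem_map_of_mem _ (((C.drop x).mem_flags _ f).mpr hf))
  by_cases h : C.edgeDir x = 0
  · exact Or.inl (h.trans (not_not.mp fun h' => edgeDir_ne_zero (Ne.symm h') hmem h))
  · refine (hC.isStraightAt_drop x).eq_or_eq_neg hf ?_
    have := (C.edgeDir_eq_zero_or_mem x).resolve_left h
    rw [C.flagDirs_mark] at this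
    exact (Multiset.mem_cons.mp this).resolve_left h

theorem IsTrivalent.edgeDir_eq_zero (hC : C.IsTrivalent) {x i : ι} (hix : i ≠ x)
    (hi : C.mark i = C.mark x) : C.edgeDir x = 0 :=
  (hC.edgeDir_eq_or_eq_neg x (f := .inr (.inr ⟨i, hix⟩)) hi).elim id fun h => h.trans neg_zero

theorem IsTrivalent.exists_forget_eq (hC : C.IsTrivalent) (x : ι) (hV : 1 < Fintype.card C.V) :
    ∃ (w : C.V) (hw : C.graph.Adj (C.mark x) w),
      C.forget x = (C.drop x).straighten (C.mark x) w hw := by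
  have : Nontrivial C.V := Fintype.one_lt_card_iff_nontrivial.mp hV
  have h : (C.drop x).valence (C.mark x) = 2 ∧ ∃ w, (C.drop x).graph.Adj (C.mark x) w :=
    ⟨((C.drop x).card_flagDirs _).symm.trans (hC.isStraightAt_drop x).card_eq,
      (C.graph.degree_pos_iff_exists_adj _).mp
        (hC.isTree.connected.preconnected.degree_pos_of_nontrivial (C.mark x))⟩
  exact ⟨h.2.choose, h.2.choose_spec, dif_pos h⟩

theorem IsTrivalent.forget (hC : C.IsTrivalent) (x : ι) (hV : 1 < Fintype.card C.V) :
    (C.forget x).IsTrivalent := by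
  obtain ⟨w, hw, heq⟩ := hC.exists_forget_eq x hV
  have hstraight := hC.isStraightAt_drop x
  have hdirs (u : ((C.drop x).straighten (C.mark x) w hw).V) :
      ((C.drop x).straighten (C.mark x) w hw).flagDirs u = C.flagDirs u.1 :=
    (flagDirs_straighten (C := C.drop x) hw (hC.drop x) hstraight u).trans
      (flagDirs_drop_of_ne u.2.symm)
  rw [heq]
  exact { straighten_isAffineTree (C := C.drop x) hw (hC.drop x) hstraight with
    card_eq := fun u => hdirs u ▸ hC.card_eq u.1
    sum_eq := fun u => hdirs u ▸ hC.sum_eq u.1 }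

theorem IsTrivalent.card_forget_ends (hC : C.IsTrivalent) (x : ι) (hV : 1 < Fintype.card C.V) :
    Fintype.card (C.forget x).ends = Fintype.card C.ends := by
  obtain ⟨w, hw, heq⟩ := hC.exists_forget_eq x hV
  rw [heq]
  rfl

theorem IsTrivalent.edgeDir_forget (hC : C.IsTrivalent) (x : ι) (hV : 1 < Fintype.card C.V)
    {i : {i : ι // i ≠ x}} (hi : C.mark i ≠ C.mark x) :
    (C.forget x).edgeDir i = C.edgeDir i := by
  obtain ⟨w, hw, heq⟩ := hC.exists_forget_eq x hV
  rw [heq]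
  refine edgeDir_congr ?_
  rw [flagDirs_straighten (C := C.drop x) hw (hC.drop x) (hC.isStraightAt_drop x),
    show ((C.drop x).straighten (C.mark x) w hw).mark i = ⟨C.mark i, hi⟩ from dif_neg hi]
  exact flagDirs_drop_of_ne hi.symm

theorem IsTrivalent.exists_forgetEquiv (hC : C.IsTrivalent) (x : ι) (hV : 1 < Fintype.card C.V) :
    ∃ e : C.deformations ≃ₗ[ℤ] (C.forget x).deformations × ℤ,
      (∀ (i : {i : ι // i ≠ x}) (k : Fin 2) (D : C.deformations), C.position (C.mark i) k D
        = (C.forget x).position ((C.forget x).mark i) k (e D).1) ∧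
      ∀ k, C.position (C.mark x) k (e.symm (0, 1)) = C.edgeDir x k := by
  obtain ⟨w, hw, heq⟩ := hC.exists_forget_eq x hV
  rw [heq]
  have hdrop := hC.drop x
  have hstraight := hC.isStraightAt_drop x
  let e := straightenEquiv (C := C.drop x) hw hdrop hstraight
  have hmark (i : {i : ι // i ≠ x}) (k : Fin 2) (D : C.deformations) :=
    (position_straightenEquiv (C := C.drop x) hw hdrop hstraight i k D).symm
  have hmove (k : Fin 2) : C.position (C.mark x) k (e.symm (0, 1)) = - C.dir (C.mark x) w k :=
    position_straightenEquiv_symm (C := C.drop x) hw hdrop hstraight k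
  rcases hC.edgeDir_eq_or_eq_neg x (f := .inl w) hw with hdir | hdir
  · refine ⟨e.trans ((LinearEquiv.refl ℤ _).prodCongr (LinearEquiv.neg ℤ)), hmark, fun k => ?_⟩
    rw [hdir]
    have hneg : (e.trans ((LinearEquiv.refl ℤ _).prodCongr (LinearEquiv.neg ℤ))).symm (0, 1)
        = - e.symm (0, 1) := by
      rw [← map_neg, LinearEquiv.trans_symm, LinearEquiv.trans_apply]
      congr 1
    exact (congrArg (C.position (C.mark x) k) hneg).trans
      ((map_neg _ _).trans (neg_eq_iff_eq_neg.mpr (hmove k)))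
  · refine ⟨e, hmark, fun k => ?_⟩
    rw [hdir]
    exact hmove k

end Forget

section Glue

variable {ι ι' κ : Type} {C : MarkedGraph ι} {C' : MarkedGraph ι'}

/-- The pairing `cross u (·)` with the image of the vertex `t`, as a linear form on deformations: it
is constant if `t` moves on a line of direction `u`. -/
def crossPosition (C : MarkedGraph ι) (u : Fin 2 → ℤ) (t : C.V) : C.deformations →ₗ[ℤ] ℤ :=
  u 0 • C.position t 1 - u 1 • C.position t 0

/-- The linear forms on deformations for the conditions that the vertices `s` are fixed and the
vertex `t` moves on a line of direction `u`. -/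
def lineForm (C : MarkedGraph ι) (s : κ → C.V) (t : C.V) (u : Fin 2 → ℤ) :
    (κ × Fin 2) ⊕ Unit → C.deformations →ₗ[ℤ] ℤ :=
  Sum.elim (fun i => C.position (s i.1) i.2) fun _ => C.crossPosition u t

/-- The linear forms on pairs of deformations of `C` and `C'` for the conditions of `lineForm` on
either curve, together with the displacement of the vertex `q` of `C'` relative to the vertex `p`
of `C`. -/
def glueForm {κ' : Type} (C : MarkedGraph ι) (s : κ → C.V) (t p : C.V) (u : Fin 2 → ℤ)
    (C' : MarkedGraph ι') (s' : κ' → C'.V) (t' q : C'.V) (u' : Fin 2 → ℤ) :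
    (((κ × Fin 2) ⊕ Unit) ⊕ ((κ' × Fin 2) ⊕ Unit)) ⊕ Fin 2 →
      C.deformations × C'.deformations →ₗ[ℤ] ℤ :=
  Sum.elim (Sum.elim (fun i => C.lineForm s t u i ∘ₗ LinearMap.fst ℤ _ _)
      fun i => C'.lineForm s' t' u' i ∘ₗ LinearMap.snd ℤ _ _)
    fun k => C'.position q k ∘ₗ LinearMap.snd ℤ _ _ - C.position p k ∘ₗ LinearMap.fst ℤ _ _

theorem lineForm_congr {s : κ → C.V} {t : C.V} {s' : κ → C'.V} {t' : C'.V}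
    {D : C.deformations} {D' : C'.deformations}
    (hs : ∀ i k, C.position (s i) k D = C'.position (s' i) k D')
    (ht : ∀ k, C.position t k D = C'.position t' k D') (u : Fin 2 → ℤ) (i : (κ × Fin 2) ⊕ Unit) :
    C.lineForm s t u i D = C'.lineForm s' t' u i D' := by
  rcases i with ⟨i, k⟩ | _
  · exact hs i k
  · exact congrArg₂ (fun a b => u 0 * a - u 1 * b) (ht 1) (ht 0)

variable [Fintype ι] [Fintype ι']

theorem IsTrivalent.finrank_forget (hC : C.IsTrivalent) (x : ι) (hV : 1 < Fintype.card C.V) :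
    Module.finrank ℤ (C.forget x).deformations + 2 = Fintype.card C.ends + Fintype.card ι := by
  have hrank := (hC.forget x hV).finrank_deformations
  have hι := Fintype.card_pos_iff.mpr ⟨x⟩
  rw [hC.card_forget_ends x hV, Fintype.card_subtype_compl, Fintype.card_subtype_eq] at hrank
  omega

theorem IsTrivalent.absDetOn_lineForm (hC : C.IsTrivalent)
    (hcard : Fintype.card C.ends = Fintype.card ι) (hV : 1 < Fintype.card C.V) (x : ι)
    (u : Fin 2 → ℤ) :
    absDetOn (C.lineForm (fun i : {i // i ≠ x} => C.mark i) (C.mark x) u)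
      = (C.forget x).evMult * (cross u (C.edgeDir x)).natAbs := by
  obtain ⟨e, hmark, hmove⟩ := hC.exists_forgetEquiv x hV
  have hrank : Fintype.card ({i // i ≠ x} × Fin 2)
      = Module.finrank ℤ (C.forget x).deformations := by
    have := hC.finrank_forget x hV
    rw [Fintype.card_prod, Fintype.card_subtype_compl, Fintype.card_subtype_eq, Fintype.card_fin]
    omega
  have hcross : C.crossPosition u (C.mark x) (e.symm (0, 1)) = cross u (C.edgeDir x) := by
    simp [crossPosition, cross, hmove]
  rw [evMult_eq_absDetOn (hC.forget x hV).toIsAffineTree, ← hcross]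
  exact absDetOn_eq_mul_natAbs e hrank fun i D => hmark i.1 i.2 D

theorem IsTrivalent.edgeDir_eq_zero_or_edgeDir_forget (hC : C.IsTrivalent)
    (hV : 1 < Fintype.card C.V) (P : ι) (x : {i // i ≠ P}) :
    C.edgeDir P = 0 ∨ (C.forget P).edgeDir x = C.edgeDir x := by
  by_cases h : C.mark x = C.mark P
  · exact Or.inl (hC.edgeDir_eq_zero x.2 h)
  · exact Or.inr (hC.edgeDir_forget P hV h)

theorem IsTrivalent.absDetOn_lineForm_forget (hC : C.IsTrivalent)
    (hcard : Fintype.card C.ends + 1 = Fintype.card ι) (hι : 2 < Fintype.card ι) (P : ι)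
    (x : {i // i ≠ P}) (u : Fin 2 → ℤ) :
    absDetOn ((C.forget P).lineForm (fun i : {i // i ≠ x} => (C.forget P).mark i)
        ((C.forget P).mark x) u)
      = ((C.forget P).forget x).evMult * (cross u ((C.forget P).edgeDir x)).natAbs := by
  have hV := hC.card_vertices
  have hP := hC.forget P (by omega)
  have hP_ends := hC.card_forget_ends P (by omega)
  have hP_marks : Fintype.card {i // i ≠ P} = Fintype.card ι - 1 := by
    rw [Fintype.card_subtype_compl, Fintype.card_subtype_eq]
  have hP_V := hP.card_vertices
  convert hP.absDetOn_lineForm (by omega) (by omega) x u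

theorem IsTrivalent.card_eq_finrank_forget (hC : C.IsTrivalent)
    (hcard : Fintype.card C.ends + 1 = Fintype.card ι) (hV : 1 < Fintype.card C.V) (P : ι)
    (x : {i // i ≠ P}) :
    Fintype.card (({i : {i // i ≠ P} // i ≠ x} × Fin 2) ⊕ Unit)
      = Module.finrank ℤ (C.forget P).deformations := by
  have hrank := hC.finrank_forget P hV
  have hP : Fintype.card {i // i ≠ P} = Fintype.card ι - 1 := by
    rw [Fintype.card_subtype_compl, Fintype.card_subtype_eq]
  rw [Fintype.card_sum, Fintype.card_prod, Fintype.card_subtype_compl, Fintype.card_subtype_eq, hP,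
    Fintype.card_fin, Fintype.card_unit]
  omega

theorem IsTrivalent.absDetOn_glueForm (hC : C.IsTrivalent) (hC' : C'.IsTrivalent)
    (hcard : Fintype.card C.ends + 1 = Fintype.card ι) (hι : 2 < Fintype.card ι)
    (hcard' : Fintype.card C'.ends + 1 = Fintype.card ι') (hι' : 2 < Fintype.card ι')
    (P : ι) (Q : ι') (x : {i // i ≠ P}) (y : {i // i ≠ Q})
    (u u' : Fin 2 → ℤ) :
    absDetOn (C.glueForm (fun i : {i // i ≠ x} => C.mark i.1) (C.mark x) (C.mark P) u
        C' (fun i : {i // i ≠ y} => C'.mark i.1) (C'.mark y) (C'.mark Q) u')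
      = ((C.forget P).forget x).evMult * ((C'.forget Q).forget y).evMult *
        interMult C P C' Q * (cross u (C.edgeDir x)).natAbs * (cross u' (C'.edgeDir y)).natAbs := by
  have hV : 1 < Fintype.card C.V := by have := hC.card_vertices; omega
  have hV' : 1 < Fintype.card C'.V := by have := hC'.card_vertices; omega
  obtain ⟨e, hmark, hmove⟩ := hC.exists_forgetEquiv P hV
  obtain ⟨e', hmark', hmove'⟩ := hC'.exists_forgetEquiv Q hV'
  have hrank := hC.card_eq_finrank_forget hcard hV P x
  have hrank' := hC'.card_eq_finrank_forget hcard' hV' Q y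
  rw [absDetOn_glue e e' hrank hrank' (p := C.position (C.mark P))
      (p' := C'.position (C'.mark Q)) (F := C.glueForm _ _ _ u C' _ _ _ u')
      (fun i w => lineForm_congr (fun j k => hmark j.1 k w.1) (fun k => hmark x k w.1) u i)
      (fun i w => lineForm_congr (fun j k => hmark' j.1 k w.2) (fun k => hmark' y k w.2) u' i)
      fun _ _ => rfl,
    hC.absDetOn_lineForm_forget hcard hι P x u, hC'.absDetOn_lineForm_forget hcard' hι' Q y u',
    funext hmove, funext hmove', interMult]
  rcases hC.edgeDir_eq_zero_or_edgeDir_forget hV P x with h | h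
  · simp [h, cross]
  rcases hC'.edgeDir_eq_zero_or_edgeDir_forget hV' Q y with h' | h'
  · simp [h', cross]
  rw [h, h']
  ring

end Glue

/-! ### Cutting at a bounded edge -/

section Cut

variable {ι : Type} {C : MarkedGraph ι} {a b : C.V}

theorem side_preconnected (C : MarkedGraph ι) (a b : C.V) : (C.side a b).graph.Preconnected := by
  have hreach (s t : C.V) (h : (C.graph.deleteEdges {s(a, b)}).Reachable s t) :
      ∀ (hs : C.OnSide a b s) (ht : C.OnSide a b t),
        (C.side a b).graph.Reachable ⟨s, hs⟩ ⟨t, ht⟩ := by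
    obtain ⟨p⟩ := h
    induction p with
    | nil => exact fun _ _ => SimpleGraph.Reachable.refl _
    | @cons s u t h _ ih =>
      intro hs ht
      have hu : C.OnSide a b u := SimpleGraph.Reachable.trans hs h.reachable
      have hsu : (C.side a b).graph.Adj ⟨s, hs⟩ ⟨u, hu⟩ := (SimpleGraph.deleteEdges_adj.mp h).1
      exact hsu.reachable.trans (ih hu ht)
  exact fun s t => hreach s.1 t.1 (SimpleGraph.Reachable.trans s.2.symm t.2) s.2 t.2

theorem IsAffineTree.side (hC : C.IsAffineTree) (a b : C.V) : (C.side a b).IsAffineTree where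
  isTree :=
    ⟨{ preconnected := C.side_preconnected a b, nonempty := ⟨⟨a, C.onSide_left a b⟩⟩ },
      hC.isTree.isAcyclic.induce _⟩
  dir_symm s t h := hC.dir_symm s.1 t.1 h

/-- A flag of the side of `a` as a flag of `C`: the new marking stands for the edge `ab`. -/
def sideFlag (C : MarkedGraph ι) (a b : C.V) : (C.side a b).Flag → C.Flag
  | .inl s => .inl s.1
  | .inr (.inl e) => .inr (.inl e.1)
  | .inr (.inr none) => .inl b
  | .inr (.inr (some i)) => .inr (.inr i.1)

theorem sideFlag_injective (hT : C.graph.IsTree) (hab : C.graph.Adj a b) :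
    Function.Injective (C.sideFlag a b) := by
  have hb (s : (C.side a b).V) : s.1 ≠ b := by
    intro h
    have hs : C.OnSide a b s.1 := s.2
    rw [h] at hs
    exact not_onSide_right hT hab hs
  rintro (s | e | _ | i) (t | e' | _ | j) h <;>
    simp only [sideFlag, Sum.inl.injEq, Sum.inr.injEq, reduceCtorEq] at h
  · rw [Subtype.ext h]
  · exact absurd h (hb s)
  · rw [Subtype.ext h]
  · exact absurd h.symm (hb t)
  · rfl
  · rw [Subtype.ext h]

theorem isFlag_sideFlag_iff (hT : C.graph.IsTree) (hab : C.graph.Adj a b) (u : (C.side a b).V)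
    (f : (C.side a b).Flag) : C.IsFlag u.1 (C.sideFlag a b f) ↔ (C.side a b).IsFlag u f := by
  have hu : C.OnSide a b u.1 := u.2
  have hb : ¬ C.OnSide a b b := not_onSide_right hT hab
  rcases f with s | e | _ | i
  · exact Iff.rfl
  · exact (Subtype.ext_iff (a1 := (C.side a b).endAt e)).symm
  · refine Iff.trans ⟨fun h => ?_, fun h => ?_⟩
      (Subtype.ext_iff (a1 := (C.side a b).mark none)).symm
    · by_contra hau
      refine hb ((C.onSide_iff_of_adj a b h fun he => ?_).mp hu)
      rcases Sym2.eq_iff.mp he with ⟨hua, -⟩ | ⟨hub, -⟩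
      · exact hau hua.symm
      · exact hb (by rwa [hub] at hu)
    · have hau : a = u.1 := h
      change C.graph.Adj u.1 b
      rwa [← hau]
  · exact (Subtype.ext_iff (a1 := (C.side a b).mark (some i))).symm

theorem exists_sideFlag_eq (u : (C.side a b).V) {f : C.Flag} (hf : C.IsFlag u.1 f) :
    ∃ f', C.sideFlag a b f' = f := by
  have hu : C.OnSide a b u.1 := u.2
  rcases f with s | e | i
  · by_cases hs : C.OnSide a b s
    · exact ⟨.inl ⟨s, hs⟩, rfl⟩
    · have hus : s(u.1, s) = s(a, b) := by
        by_contra hne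
        exact hs ((C.onSide_iff_of_adj a b hf hne).mp hu)
      rcases Sym2.eq_iff.mp hus with ⟨-, rfl⟩ | ⟨-, rfl⟩
      · exact ⟨.inr (.inr none), rfl⟩
      · exact absurd (C.onSide_left _ b) hs
  · exact ⟨.inr (.inl ⟨e, (show C.endAt e = u.1 from hf) ▸ hu⟩), rfl⟩
  · exact ⟨.inr (.inr (some ⟨i, (show C.mark i = u.1 from hf) ▸ hu⟩)), rfl⟩

theorem flagDirs_side [Fintype ι] (hT : C.graph.IsTree) (hab : C.graph.Adj a b)
    (h₀ : C.dir a b = 0) (u : (C.side a b).V) : (C.side a b).flagDirs u = C.flagDirs u.1 := by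
  refine flagDirs_eq_map (sideFlag_injective hT hab)
    (fun f => by rw [mem_flags, isFlag_sideFlag_iff hT hab])
    (fun f hf => exists_sideFlag_eq u ((C.mem_flags _ f).mp hf)) fun f hf => ?_
  rcases f with s | e | _ | i
  · rfl
  · rfl
  · have hau : a = u.1 := congrArg Subtype.val (show (C.side a b).mark none = u from hf)
    exact (hau ▸ h₀ : C.dir u.1 b = 0).symm
  · rfl

theorem IsTrivalent.side [Fintype ι] (hC : C.IsTrivalent) (hab : C.graph.Adj a b)
    (h₀ : C.dir a b = 0) : (C.side a b).IsTrivalent where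
  toIsAffineTree := hC.toIsAffineTree.side a b
  card_eq u := by rw [flagDirs_side hC.isTree hab h₀, hC.card_eq]
  sum_eq u := by rw [flagDirs_side hC.isTree hab h₀, hC.sum_eq]

/-- Restriction of deformations to the part on the side of `a`. -/
def restrict (C : MarkedGraph ι) (a b : C.V) : C.deformations →ₗ[ℤ] (C.side a b).deformations where
  toFun D := ⟨(fun s => D.1.1 s.1, fun s t => D.1.2 s.1 t.1), fun s t => D.2.1 s.1 t.1,
    fun s t h => D.2.2.1 s.1 t.1 h, fun s t h k => D.2.2.2 s.1 t.1 h k⟩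
  map_add' _ _ := rfl
  map_smul' _ _ := rfl

/-- Translations, as deformations. -/
def translation (C : MarkedGraph ι) : (Fin 2 → ℤ) →ₗ[ℤ] C.deformations where
  toFun z := ⟨(fun _ => z, fun _ _ => 0), fun _ _ => rfl, fun _ _ _ => rfl,
    fun _ _ _ _ => by simp⟩
  map_add' _ _ := Subtype.ext (Prod.ext rfl (funext₂ fun _ _ => (add_zero 0).symm))
  map_smul' c _ := Subtype.ext (Prod.ext rfl (funext₂ fun _ _ => (mul_zero c).symm))

theorem edgeLength_add_translation (D : C.deformations) (z : Fin 2 → ℤ) (s t : C.V) :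
    C.edgeLength s t (D + C.translation z) = C.edgeLength s t D :=
  add_zero _

/-- The restrictions of a deformation to both parts, the one on the side of `b` translated by a
given vector, together with the length of the edge `ab`. -/
def cut (C : MarkedGraph ι) (a b : C.V) : (Fin 2 → ℤ) × C.deformations →ₗ[ℤ]
    ((C.side a b).deformations × (C.side b a).deformations) × ℤ :=
  ((C.restrict a b ∘ₗ LinearMap.snd ℤ _ _).prod
    (C.restrict b a ∘ₗ LinearMap.snd ℤ _ _ + (C.side b a).translation ∘ₗ LinearMap.fst ℤ _ _)).prod
    (C.edgeLength a b ∘ₗ LinearMap.snd ℤ _ _)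

theorem forall_adj_of_forall_side (hT : C.graph.IsTree) {P : C.V → C.V → Prop}
    (hP : ∀ s t, P s t → P t s) (hab : P a b)
    (ha : ∀ s t, C.OnSide a b s → C.OnSide a b t → C.graph.Adj s t → P s t)
    (hb : ∀ s t, C.OnSide b a s → C.OnSide b a t → C.graph.Adj s t → P s t)
    (s t : C.V) (hst : C.graph.Adj s t) : P s t := by
  by_cases he : s(s, t) = s(a, b)
  · rcases Sym2.eq_iff.mp he with ⟨rfl, rfl⟩ | ⟨rfl, rfl⟩
    · exact hab
    · exact hP _ _ hab
  · rcases onSide_or_onSide hT a b s with hs | hs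
    · exact ha s t hs ((C.onSide_iff_of_adj a b hst he).mp hs) hst
    · exact hb s t hs ((C.onSide_iff_of_adj b a hst (by rwa [Sym2.eq_swap (a := b)])).mp hs) hst

theorem cut_injective (hC : C.IsAffineTree) (a b : C.V) : Function.Injective (C.cut a b) := by
  refine (injective_iff_map_eq_zero _).mpr fun ⟨z, D⟩ h => ?_
  have ha : C.restrict a b D = 0 := congrArg (fun y => y.1.1) h
  have hb : C.restrict b a D + (C.side b a).translation z = 0 := congrArg (fun y => y.1.2) h
  have hlen : C.edgeLength a b D = 0 := congrArg Prod.snd h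
  have hD : D = 0 := by
    refine deformation_ext hC a (fun k => ?_)
      (forall_adj_of_forall_side hC.isTree (fun s t hst => ?_) hlen (fun s t hs ht _ => ?_)
        fun s t hs ht _ => ?_)
    · exact congrArg ((C.side a b).position ⟨a, C.onSide_left a b⟩ k) ha
    · rw [C.edgeLength_symm s t, hst, C.edgeLength_symm t s]
    · exact congrArg ((C.side a b).edgeLength ⟨s, hs⟩ ⟨t, ht⟩) ha
    · exact (edgeLength_add_translation (C.restrict b a D) z ⟨s, hs⟩ ⟨t, ht⟩).symm.trans
        (congrArg ((C.side b a).edgeLength ⟨s, hs⟩ ⟨t, ht⟩) hb)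
  subst hD
  refine Prod.ext (funext fun k => ?_) rfl
  exact (zero_add (z k)).symm.trans
    (congrArg ((C.side b a).position ⟨b, C.onSide_left b a⟩ k) hb)

theorem exists_length_of_side (hT : C.graph.IsTree) (hab : C.graph.Adj a b)
    (D : (C.side a b).deformations) (D' : (C.side b a).deformations) (m : ℤ) :
    ∃ l : C.V → C.V → ℤ, (∀ s t, l s t = l t s) ∧ l a b = m ∧
      (∀ s t : (C.side a b).V, l s.1 t.1 = (C.side a b).edgeLength s t D) ∧
      ∀ s t : (C.side b a).V, l s.1 t.1 = (C.side b a).edgeLength s t D' := by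
  have hnot (s : (C.side b a).V) : ¬ C.OnSide a b s.1 := (onSide_symm_iff_not hT hab s.1).mp s.2
  have hnota : ¬ C.OnSide b a a := fun h => hnot ⟨a, h⟩ (C.onSide_left a b)
  refine ⟨fun s t =>
    if h : C.OnSide a b s ∧ C.OnSide a b t then (C.side a b).edgeLength ⟨s, h.1⟩ ⟨t, h.2⟩ D
    else if h : C.OnSide b a s ∧ C.OnSide b a t then (C.side b a).edgeLength ⟨s, h.1⟩ ⟨t, h.2⟩ D'
    else m, fun s t => ?_, ?_, fun s t => dif_pos ⟨s.2, t.2⟩, fun s t => ?_⟩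
  · simp only [and_comm (a := C.OnSide a b s), and_comm (a := C.OnSide b a s),
      (C.side a b).edgeLength_symm ⟨t, _⟩ ⟨s, _⟩ D, (C.side b a).edgeLength_symm ⟨t, _⟩ ⟨s, _⟩ D']
  · exact (dif_neg fun h => not_onSide_right hT hab h.2).trans (dif_neg fun h => hnota h.1)
  · exact (dif_neg fun h => hnot s h.1).trans (dif_pos ⟨s.2, t.2⟩)

theorem cut_surjective (hC : C.IsAffineTree) (hab : C.graph.Adj a b) :
    Function.Surjective (C.cut a b) := by
  rintro ⟨⟨D, D'⟩, m⟩
  obtain ⟨l, hl, hm, hD, hD'⟩ := exists_length_of_side hC.isTree hab D D' m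
  obtain ⟨E, hpos, hlen⟩ := exists_deformation hC a
    (fun k => (C.side a b).position ⟨a, C.onSide_left a b⟩ k D) hl
  refine ⟨(fun k => (C.side b a).position ⟨b, C.onSide_left b a⟩ k D' - C.position b k E, E),
    Prod.ext (Prod.ext ?_ ?_) ((hlen a b hab).trans hm)⟩
  · exact deformation_ext (hC.side a b) ⟨a, C.onSide_left a b⟩ hpos
      fun s t hst => (hlen s.1 t.1 hst).trans (hD s t)
  · refine deformation_ext (hC.side b a) ⟨b, C.onSide_left b a⟩ (fun k => ?_)
      fun s t hst => (add_zero _).trans ((hlen s.1 t.1 hst).trans (hD' s t))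
    exact add_sub_cancel (C.position b k E) _

/-- Deformations of both parts, together with a length of the edge `ab`, are deformations of `C` up
to a translation of one part. -/
def cutEquiv (hC : C.IsAffineTree) (hab : C.graph.Adj a b) :
    ((Fin 2 → ℤ) × C.deformations) ≃ₗ[ℤ]
      ((C.side a b).deformations × (C.side b a).deformations) × ℤ :=
  LinearEquiv.ofBijective (C.cut a b) ⟨cut_injective hC a b, cut_surjective hC hab⟩

end Cut

/-! ### Cutting the matrix of `π̃` -/

section PiTilde

variable {n l : ℕ}

/-- The length coordinate of `M₄`, as a linear form on deformations. -/
def sepForm (C : MarkedGraph (Fin n)) (hn : 4 ≤ n) : C.deformations →ₗ[ℤ] ℤ :=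
  ∑ e : C.graph.edgeSet,
    (if C.Separates e (first4 hn 0) (first4 hn 1) (first4 hn 2) (first4 hn 3) ∨
        C.Separates e (first4 hn 0) (first4 hn 2) (first4 hn 1) (first4 hn 3) ∨
        C.Separates e (first4 hn 0) (first4 hn 3) (first4 hn 1) (first4 hn 2) then 1 else 0 : ℤ) •
      C.edgeLength (Quot.out (e : Sym2 C.V)).1 (Quot.out (e : Sym2 C.V)).2

/-- The rows of the matrix of `π̃`, as linear forms on deformations. -/
def piForm (C : MarkedGraph (Fin n)) (hn : 4 ≤ n) (L : TropicalCurve l) :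
    Fin 2 ⊕ ({i : Fin n // 2 ≤ i.val} × Fin 2) ⊕ Unit → C.deformations →ₗ[ℤ] ℤ
  | .inl k => C.crossPosition (L.edgeVector (C.ev (first4 hn (Fin.castLE (by norm_num) k))))
      (C.mark (first4 hn (Fin.castLE (by norm_num) k)))
  | .inr (.inl i) => C.position (C.mark i.1) i.2
  | .inr (.inr _) => C.sepForm hn

theorem piMult_eq_absDetOn {C : MarkedGraph (Fin n)} (hC : C.IsAffineTree) (hn : 4 ≤ n)
    (L : TropicalCurve l) : C.piMult hn L = absDetOn (C.piForm hn L) := by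
  have h := hC.isTree.connected.nonempty
  have hlen (e : C.graph.edgeSet) (c : Fin 2 ⊕ C.graph.edgeSet) :
      C.edgeLength (Quot.out (e : Sym2 C.V)).1 (Quot.out (e : Sym2 C.V)).2
        (coordBasis hC h.some c) = (Pi.single c 1 : _ → ℤ) (.inr e) :=
    congrFun (coordMap_coordBasis hC h.some c) (.inr e)
  rw [piMult, dif_pos h, absDetOn_eq_absDet _ (coordBasis hC h.some)]
  congr 1
  ext (k | i | _) c
  · simp only [Matrix.of_apply, piForm, crossPosition, LinearMap.sub_apply, LinearMap.smul_apply,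
      position_coordBasis]
    rfl
  · exact (position_coordBasis hC _ _ _ _).symm
  · simp only [Matrix.of_apply, piForm, sepForm, LinearMap.sum_apply, LinearMap.smul_apply, hlen]
    rcases c with k | e
    · simp [piMatrix]
    · simp [piMatrix, Pi.single_apply]

theorem sepForm_eq_edgeLength {C : MarkedGraph (Fin n)} (hn : 4 ≤ n) {a b : C.V}
    (hab : C.graph.Adj a b)
    (hsep : C.Separates ⟨s(a, b), hab⟩ (first4 hn 0) (first4 hn 2) (first4 hn 1) (first4 hn 3))
    (D : C.deformations)
    (hD : ∀ s t, C.graph.Adj s t → s(s, t) ≠ s(a, b) → C.edgeLength s t D = 0) :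
    C.sepForm hn D = C.edgeLength a b D := by
  have hout (s t : C.V) : C.edgeLength (Quot.out s(s, t)).1 (Quot.out s(s, t)).2 D
      = C.edgeLength s t D := apply_out_mk D.2.1 s t
  rw [sepForm, LinearMap.sum_apply, Finset.sum_eq_single ⟨s(a, b), hab⟩]
  · rw [if_pos (Or.inr (Or.inl hsep)), one_smul, hout]
  · rintro ⟨e, he⟩ - hne
    induction e with
    | _ s t =>
      rw [LinearMap.smul_apply, hout, hD s t he fun h => hne (Subtype.ext h), smul_zero]
  · exact fun h => absurd (Finset.mem_univ _) h

end PiTilde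

section Cut

variable {ι : Type} {C : MarkedGraph ι} {a b : C.V}

theorem edgeLength_cutEquiv_symm (hC : C.IsAffineTree) (hab : C.graph.Adj a b) (m : ℤ) :
    C.edgeLength a b ((cutEquiv hC hab).symm (0, m)).2 = m ∧
      ∀ s t, C.graph.Adj s t → s(s, t) ≠ s(a, b) →
        C.edgeLength s t ((cutEquiv hC hab).symm (0, m)).2 = 0 := by
  have h : C.cut a b ((cutEquiv hC hab).symm (0, m)) = (0, m) :=
    (cutEquiv hC hab).apply_symm_apply (0, m)
  set w := (cutEquiv hC hab).symm (0, m)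
  have ha : C.restrict a b w.2 = 0 := congrArg (fun y => y.1.1) h
  have hb : C.restrict b a w.2 + (C.side b a).translation w.1 = 0 := congrArg (fun y => y.1.2) h
  refine ⟨congrArg Prod.snd h, fun s t hst hne => ?_⟩
  rcases onSide_or_onSide hC.isTree a b s with hs | hs
  · have ht := (C.onSide_iff_of_adj a b hst hne).mp hs
    exact congrArg ((C.side a b).edgeLength ⟨s, hs⟩ ⟨t, ht⟩) ha
  · have ht := (C.onSide_iff_of_adj b a hst (by rwa [Sym2.eq_swap (a := b)])).mp hs
    exact (edgeLength_add_translation (C.restrict b a w.2) w.1 ⟨s, hs⟩ ⟨t, ht⟩).symm.trans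
      (congrArg ((C.side b a).edgeLength ⟨s, hs⟩ ⟨t, ht⟩) hb)

/-- If `ab` is contracted, the displacement of one end of the cut edge relative to the other is the
translation coordinate of `cutEquiv`. -/
theorem absDetOn_cut {m m' : Type} [Fintype m] [Fintype m'] (hC : C.IsAffineTree)
    (hab : C.graph.Adj a b) (h₀ : C.dir a b = 0) (σ : Fin 2 ⊕ m ≃ m')
    {F : m' → ((C.side a b).deformations × (C.side b a).deformations) × ℤ →ₗ[ℤ] ℤ}
    {g : m → C.deformations →ₗ[ℤ] ℤ}
    (hF : ∀ k w, F (σ (.inl k)) w = (C.side b a).position ((C.side b a).mark none) k w.1.2 -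
      (C.side a b).position ((C.side a b).mark none) k w.1.1)
    (hg : ∀ j D, F (σ (.inr j)) (C.cut a b (0, D)) = g j D) : absDetOn F = absDetOn g := by
  have hpos (k : Fin 2) (D : C.deformations) : C.position b k D = C.position a k D := by
    simp [C.position_of_adj hab, h₀]
  have htrans (k : Fin 2) (w) : F (σ (.inl k)) w = ((cutEquiv hC hab).symm w).1 k := by
    obtain ⟨⟨z, D⟩, rfl⟩ := (cutEquiv hC hab).surjective w
    rw [hF, LinearEquiv.symm_apply_apply]
    change C.position b k D + z k - C.position a k D = z k
    rw [hpos, add_sub_cancel_left]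
  rw [← absDetOn_reindex F σ, absDetOn_eq_mul (cutEquiv hC hab).symm (f := LinearMap.proj)
    (by simp) htrans hg, absDetOn_proj, one_mul]

end Cut

end MarkedGraph

/-- Rearrangement of the rows of the matrix of `π̃` if the markings are distributed to two parts: on
the right are the rows of `glueForm` and the length coordinate of `M₄`. -/
def rowEquiv {T κ κ' : Type} (τ : T ≃ κ ⊕ κ') :
    Fin 2 ⊕ (Fin 2 ⊕ (T × Fin 2) ⊕ Unit) ≃
      ((((κ × Fin 2) ⊕ Unit) ⊕ ((κ' × Fin 2) ⊕ Unit)) ⊕ Fin 2) ⊕ Unit where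
  toFun
    | .inl k => .inl (.inr k)
    | .inr (.inl 0) => .inl (.inl (.inl (.inr ())))
    | .inr (.inl 1) => .inl (.inl (.inr (.inr ())))
    | .inr (.inr (.inl (t, k))) => .inl (.inl ((τ t).map (.inl ⟨·, k⟩) (.inl ⟨·, k⟩)))
    | .inr (.inr (.inr _)) => .inr ()
  invFun
    | .inl (.inl (.inl (.inl (i, k)))) => .inr (.inr (.inl (τ.symm (.inl i), k)))
    | .inl (.inl (.inr (.inl (i, k)))) => .inr (.inr (.inl (τ.symm (.inr i), k)))
    | .inl (.inl (.inl (.inr _))) => .inr (.inl 0)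
    | .inl (.inl (.inr (.inr _))) => .inr (.inl 1)
    | .inl (.inr k) => .inl k
    | .inr _ => .inr (.inr (.inr ()))
  left_inv := by
    rintro (k | k | ⟨t, k⟩ | _)
    · rfl
    · fin_cases k <;> rfl
    · obtain ⟨i | i, rfl⟩ := τ.symm.surjective t <;> simp
    · rfl
  right_inv := by
    rintro ((((⟨i, k⟩ | _) | ⟨i, k⟩ | _) | k) | _) <;> simp

namespace MarkedGraph

section Markings

variable {ι : Type} {C : MarkedGraph ι} {a b : C.V}

/-- The markings of the side of `a` other than the cut edge and `x`. -/
abbrev OtherMarks (C : MarkedGraph ι) (a b : C.V) (x : ι) (hx : C.OnSide a b (C.mark x)) : Type :=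
  {i : {i : Option {i : ι // C.OnSide a b (C.mark i)} // i ≠ none} //
    i ≠ ⟨some ⟨x, hx⟩, Option.some_ne_none _⟩}

/-- A marking of `C` on the side of `a` as a marking of this side. -/
def toOtherMarks {x i : ι} (hx : C.OnSide a b (C.mark x)) (hi : C.OnSide a b (C.mark i))
    (hne : i ≠ x) : C.OtherMarks a b x hx :=
  ⟨⟨some ⟨i, hi⟩, Option.some_ne_none _⟩, fun h => hne (by simpa using h)⟩

/-- The markings of `C` other than `x` and `y` are distributed to the two sides. -/
def sideMarksEquiv (hT : C.graph.IsTree) (hab : C.graph.Adj a b) {x y : ι}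
    (hx : C.OnSide a b (C.mark x)) (hy : C.OnSide b a (C.mark y)) {p : ι → Prop}
    (hp : ∀ i, p i ↔ i ≠ x ∧ i ≠ y) :
    {i : ι // p i} ≃ C.OtherMarks a b x hx ⊕ C.OtherMarks b a y hy :=
  Equiv.ofBijective
    (fun i => if h : C.OnSide a b (C.mark i) then .inl (toOtherMarks hx h ((hp i).mp i.2).1)
      else .inr (toOtherMarks hy ((onSide_symm_iff_not hT hab _).mpr h) ((hp i).mp i.2).2)) (by
    constructor
    · intro i j h
      by_cases hi : C.OnSide a b (C.mark i) <;> by_cases hj : C.OnSide a b (C.mark j) <;>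
        simp_all [toOtherMarks, Subtype.ext_iff]
    · have hnot {i : ι} (hi : C.OnSide b a (C.mark i)) : ¬ C.OnSide a b (C.mark i) :=
        (onSide_symm_iff_not hT hab _).mp hi
      rintro (⟨⟨_ | ⟨i, hi⟩, hnone⟩, hne⟩ | ⟨⟨_ | ⟨i, hi⟩, hnone⟩, hne⟩)
      · exact absurd rfl hnone
      · refine ⟨⟨i, (hp i).mpr ⟨fun h => hne ?_, fun h => hnot hy (h ▸ hi)⟩⟩, dif_pos hi⟩
        simp [h]
      · exact absurd rfl hnone
      · refine ⟨⟨i, (hp i).mpr ⟨fun h => hnot hi (h ▸ hx), fun h => hne ?_⟩⟩, dif_neg (hnot hi)⟩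
        simp [h])

theorem card_ends_of_hasDegree {d : ℕ} (h : C.HasDegree d) : Fintype.card C.ends = 3 * d := by
  simpa [mul_comm] using congrArg Multiset.card h

end Markings

section Splitting

variable {n l : ℕ} {C : MarkedGraph (Fin n)} {hn : 4 ≤ n} {a b : C.V} {d₁ d₂ : ℕ}

theorem SplitsAt.card_left (hT : C.graph.IsTree) (hE : C.SplitsAt hn a b d₁ d₂) :
    Fintype.card {i // C.OnSide a b (C.mark i)} = 3 * d₁ := by
  have h₁ := (onSide_symm_iff_not hT hE.adj _).mp hE.x2
  have h₃ := (onSide_symm_iff_not hT hE.adj _).mp hE.x4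
  have hval (j : Fin 4) : (first4 hn j).val = j.val := rfl
  have hs : {i | C.OnSide a b (C.mark i)} = insert (first4 hn 0) (insert (first4 hn 2)
      {i : Fin n | 4 ≤ i.val ∧ C.OnSide a b (C.mark i)}) := by
    ext i
    by_cases hi : i.val < 4
    · obtain ⟨j, rfl⟩ : ∃ j, first4 hn j = i := ⟨⟨i, hi⟩, rfl⟩
      fin_cases j <;> simp [hE.x1, hE.x3, h₁, h₃, hval, Fin.ext_iff]
    · have h0 : i.val ≠ 0 := by omega
      have h2 : i.val ≠ 2 := by omega
      simp [hval, Fin.ext_iff, h0, h2, not_lt.mp hi]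
  have h := hE.others
  have hpos := hE.left_pos
  rw [← Nat.card_eq_fintype_card]
  change Set.ncard {i | C.OnSide a b (C.mark i)} = _
  change Set.ncard {i : Fin n | _} = _ at h
  rw [hs, Set.ncard_insert_of_notMem, Set.ncard_insert_of_notMem, h]
  · omega
  · simp [hval]
  · simp [hval, Fin.ext_iff]

theorem SplitsAt.card_right (hT : C.graph.IsTree) (hE : C.SplitsAt hn a b d₁ d₂)
    (hd : n = 3 * (d₁ + d₂)) : Fintype.card {i // C.OnSide b a (C.mark i)} = 3 * d₂ := by
  have h₁ := hE.card_left hT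
  have h₂ : Fintype.card {i // C.OnSide b a (C.mark i)}
      = Fintype.card {i // ¬ C.OnSide a b (C.mark i)} :=
    Fintype.card_congr (Equiv.subtypeEquivRight fun i => onSide_symm_iff_not hT hE.adj _)
  rw [Fintype.card_subtype_compl, Fintype.card_fin] at h₂
  omega

end Splitting

section Product

variable {n l : ℕ} {C : MarkedGraph (Fin n)} {a b : C.V}

/-- `glueForm` for the two sides of the edge `ab`, where all markings other than `x` and `y` are
fixed. -/
abbrev sideForm (C : MarkedGraph (Fin n)) (a b : C.V) {x y : Fin n} (hx : C.OnSide a b (C.mark x))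
    (hy : C.OnSide b a (C.mark y)) (u v : Fin 2 → ℤ) :
    (((C.OtherMarks a b x hx × Fin 2) ⊕ Unit) ⊕ ((C.OtherMarks b a y hy × Fin 2) ⊕ Unit)) ⊕ Fin 2 →
      (C.side a b).deformations × (C.side b a).deformations →ₗ[ℤ] ℤ :=
  (C.side a b).glueForm (fun i : C.OtherMarks a b x hx => (C.side a b).mark i.1)
    ((C.side a b).mark (some ⟨x, hx⟩)) ((C.side a b).mark none) u
    (C.side b a) (fun i : C.OtherMarks b a y hy => (C.side b a).mark i.1)
    ((C.side b a).mark (some ⟨y, hy⟩)) ((C.side b a).mark none) v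

/-- The forms `sideForm` together with the length coordinate of `M₄`, as linear forms on the
deformations of both sides and the length of the edge `ab`. -/
def cutForm {x y : Fin n} (hC : C.IsAffineTree) (hab : C.graph.Adj a b) (hn : 4 ≤ n)
    (hx : C.OnSide a b (C.mark x)) (hy : C.OnSide b a (C.mark y)) (u v : Fin 2 → ℤ) :
    ((((C.OtherMarks a b x hx × Fin 2) ⊕ Unit) ⊕ ((C.OtherMarks b a y hy × Fin 2) ⊕ Unit)) ⊕
        Fin 2) ⊕ Unit →
      ((C.side a b).deformations × (C.side b a).deformations) × ℤ →ₗ[ℤ] ℤ :=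
  Sum.elim (fun i => C.sideForm a b hx hy u v i ∘ₗ LinearMap.fst ℤ _ _)
    fun _ => C.sepForm hn ∘ₗ LinearMap.snd ℤ _ _ ∘ₗ (cutEquiv hC hab).symm.toLinearMap

variable {hn : 4 ≤ n} {d₁ d₂ : ℕ}

theorem two_le_iff_ne_first4 (hn : 4 ≤ n) (i : Fin n) :
    2 ≤ i.val ↔ i ≠ first4 hn 0 ∧ i ≠ first4 hn 1 := by
  simp only [first4, ne_eq, Fin.ext_iff, Fin.val_castLE, Fin.val_zero, Fin.val_one]
  omega

theorem cutForm_cut (hC : C.IsAffineTree) (hab : C.graph.Adj a b)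
    (hx : C.OnSide a b (C.mark (first4 hn 0))) (hy : C.OnSide b a (C.mark (first4 hn 1)))
    (L : TropicalCurve l) (j : Fin 2 ⊕ ({i : Fin n // 2 ≤ i.val} × Fin 2) ⊕ Unit)
    (D : C.deformations) :
    cutForm hC hab hn hx hy (L.edgeVector (C.ev (first4 hn 0))) (L.edgeVector (C.ev (first4 hn 1)))
        (rowEquiv (sideMarksEquiv hC.isTree hab hx hy (two_le_iff_ne_first4 hn)) (.inr j))
        (C.cut a b (0, D))
      = C.piForm hn L j D := by
  rcases j with k | ⟨i, k⟩ | _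
  · fin_cases k
    · rfl
    · exact congrArg₂ (fun s t : ℤ => L.edgeVector (C.ev (first4 hn 1)) 0 * s -
        L.edgeVector (C.ev (first4 hn 1)) 1 * t) (add_zero _) (add_zero _)
  · by_cases hi : C.OnSide a b (C.mark i)
    · simp only [rowEquiv, sideMarksEquiv, Equiv.ofBijective_apply, Equiv.coe_fn_mk, hi,
        ↓reduceDIte, Sum.map_inl]
      rfl
    · simp only [rowEquiv, sideMarksEquiv, Equiv.ofBijective_apply, Equiv.coe_fn_mk, hi,
        ↓reduceDIte, Sum.map_inr]
      exact add_zero _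
  · exact congrArg (fun w => C.sepForm hn w.2) ((cutEquiv hC hab).symm_apply_apply (0, D))

theorem SplitsAt.sepForm_cutEquiv_symm (hC : C.IsAffineTree) (hE : C.SplitsAt hn a b d₁ d₂)
    (m : ℤ) : C.sepForm hn ((cutEquiv hC hE.adj).symm (0, m)).2 = m := by
  obtain ⟨hab, hne⟩ := edgeLength_cutEquiv_symm hC hE.adj m
  rw [sepForm_eq_edgeLength hn hE.adj ⟨a, b, rfl, hE.x1, hE.x3, hE.x2, hE.x4⟩ _ hne, hab]

theorem SplitsAt.side_isTrivalent_right (hC : C.IsTrivalent) (hE : C.SplitsAt hn a b d₁ d₂) :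
    (C.side b a).IsTrivalent :=
  hC.side hE.adj.symm (by rw [hC.dir_symm _ _ hE.adj, hE.contracted, neg_zero])

theorem SplitsAt.finrank_side (hC : C.IsTrivalent) (hE : C.SplitsAt hn a b d₁ d₂)
    (hd : n = 3 * (d₁ + d₂)) :
    Module.finrank ℤ (C.side a b).deformations = 6 * d₁ ∧
      Module.finrank ℤ (C.side b a).deformations = 6 * d₂ := by
  have hrank := (hC.side hE.adj hE.contracted).finrank_deformations
  have hrank' := (hE.side_isTrivalent_right hC).finrank_deformations
  rw [Fintype.card_option, hE.card_left hC.isTree, card_ends_of_hasDegree hE.degree_left] at hrank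
  rw [Fintype.card_option, hE.card_right hC.isTree hd, card_ends_of_hasDegree hE.degree_right]
    at hrank'
  omega

theorem card_otherMarks {x : Fin n} (hx : C.OnSide a b (C.mark x)) :
    Fintype.card (C.OtherMarks a b x hx) + 1 = Fintype.card {i // C.OnSide a b (C.mark i)} := by
  have hpos := Fintype.card_pos_iff.mpr ⟨(⟨x, hx⟩ : {i // C.OnSide a b (C.mark i)})⟩
  rw [Fintype.card_subtype_compl, Fintype.card_subtype_eq, Fintype.card_subtype_compl,
    Fintype.card_subtype_eq, Fintype.card_option]
  omega

theorem SplitsAt.piMult_eq_absDetOn_sideForm (hC : C.IsTrivalent) (hE : C.SplitsAt hn a b d₁ d₂)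
    (hd : n = 3 * (d₁ + d₂)) (L : TropicalCurve l) :
    C.piMult hn L = absDetOn (C.sideForm a b hE.x1 hE.x2 (L.edgeVector (C.ev (first4 hn 0)))
      (L.edgeVector (C.ev (first4 hn 1)))) := by
  have hC' := hC.toIsAffineTree
  obtain ⟨hrank, hrank'⟩ := hE.finrank_side hC hd
  have hcard := card_otherMarks hE.x1
  have hcard' := card_otherMarks hE.x2
  rw [hE.card_left hC.isTree] at hcard
  rw [hE.card_right hC.isTree hd] at hcard'
  rw [piMult_eq_absDetOn hC', ← absDetOn_cut hC' hE.adj hE.contracted (rowEquiv _)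
      (F := cutForm hC' hE.adj hn hE.x1 hE.x2 _ _) (fun _ _ => rfl) (cutForm_cut hC' hE.adj _ _ L),
    absDetOn_eq_mul_natAbs (LinearEquiv.refl ℤ _) ?_ fun _ _ => rfl]
  · change _ * (C.sepForm hn ((cutEquiv hC' hE.adj).symm (0, 1)).2).natAbs = _
    rw [hE.sepForm_cutEquiv_symm hC', Int.natAbs_one, mul_one]
  · simp only [Fintype.card_sum, Fintype.card_prod, Fintype.card_fin, Fintype.card_unit,
      Module.finrank_prod, hrank, hrank']
    omega

theorem SplitsAt.absDetOn_sideForm (hC : C.IsTrivalent) (hE : C.SplitsAt hn a b d₁ d₂)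
    (hd : n = 3 * (d₁ + d₂)) (u v : Fin 2 → ℤ) :
    absDetOn (C.sideForm a b hE.x1 hE.x2 u v) =
      C.sideEvMult a b (first4 hn 0) hE.x1 * C.sideEvMult b a (first4 hn 1) hE.x2 *
        interMult (C.side a b) none (C.side b a) none *
        (cross u ((C.side a b).edgeDir (some ⟨first4 hn 0, hE.x1⟩))).natAbs *
        (cross v ((C.side b a).edgeDir (some ⟨first4 hn 1, hE.x2⟩))).natAbs := by
  have hleft := hE.card_left hC.isTree
  have hright := hE.card_right hC.isTree hd
  have hends := card_ends_of_hasDegree hE.degree_left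
  have hends' := card_ends_of_hasDegree hE.degree_right
  have hpos := hE.left_pos
  have hpos' := hE.right_pos
  rw [sideEvMult, sideEvMult]
  convert (hC.side hE.adj hE.contracted).absDetOn_glueForm (hE.side_isTrivalent_right hC)
    (by rw [Fintype.card_option]; omega) (by rw [Fintype.card_option]; omega)
    (by rw [Fintype.card_option]; omega) (by rw [Fintype.card_option]; omega) none none
    ⟨some ⟨first4 hn 0, hE.x1⟩, Option.some_ne_none _⟩
    ⟨some ⟨first4 hn 1, hE.x2⟩, Option.some_ne_none _⟩ u v

end Product

end MarkedGraph

end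

end TropicalTangency

theorem mainTheorem5_general {n l : ℕ} (hn : 4 ≤ n) (L : TropicalCurve l) (C : MarkedGraph (Fin n))
    (hC : C.IsPlaneTropicalCurve) (hgen : C.IsGeneric hn L) (d₁ d₂ : ℕ) (hd : n = 3 * (d₁ + d₂))
    (a b : C.V) (hE : C.SplitsAt hn a b d₁ d₂) :
    C.piMult hn L =
      C.sideEvMult a b (first4 hn 0) hE.x1 *
      C.sideEvMult b a (first4 hn 1) hE.x2 *
      MarkedGraph.interMult (C.side a b) none (C.side b a) none *
      (C.side a b).interMultAt L (some ⟨first4 hn 0, hE.x1⟩) *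
      (C.side b a).interMultAt L (some ⟨first4 hn 1, hE.x2⟩) := by
  have hT := hC.isTrivalent hgen.1
  rw [hE.piMult_eq_absDetOn_sideForm hT hd L, hE.absDetOn_sideForm hT hd]
  rfl

theorem mainTheorem5 (d l : ℕ) (hn : 4 ≤ 3 * d) (L : TropicalCurve l)
    (q : {i : Fin (3 * d) // 2 ≤ i.val} → Fin 2 → ℝ) (len : ℝ) (hlen : 0 < len)
    (hQ : InGeneralPosition hn d L (q, M4.typeB len hlen))
    (C : MarkedGraph (Fin (3 * d))) (hC : C.InDomain hn d L)
    (hCQ : C.piTilde hn = (q, M4.typeB len hlen))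
    (d₁ d₂ : ℕ) (hdd : d₁ + d₂ = d) (a b : C.V) (hE : C.SplitsAt hn a b d₁ d₂) :
    C.piMult hn L =
      C.sideEvMult a b (first4 hn 0) hE.x1 *
      C.sideEvMult b a (first4 hn 1) hE.x2 *
      MarkedGraph.interMult (C.side a b) none (C.side b a) none *
      (C.side a b).interMultAt L (some ⟨first4 hn 0, hE.x1⟩) *
      (C.side b a).interMultAt L (some ⟨first4 hn 1, hE.x2⟩) :=
  mainTheorem5_general hn L C hC.isCurve (hQ.2 C hC hCQ) d₁ d₂ (by rw [hdd]) a b hE
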